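/- Let $d\in\{2,3\}$, let $\mathcal O\subset\mathbb R^d$ be a bounded domain (non-empty, open, connected) with smooth ($C^\infty$) boundary, and let $n\ge 1$ be a natural number or, more generally, a real number. For $s \in \mathbb R$ write $s^{2n-1}:=|s|^{2n-2}s$, which is the usual power when $n$ is a natural number. Let $\mathcal H=L^2(\mathcal O)$ (real-valued functions, norm $|\cdot|_{\mathcal H}$) and $\mathcal V=H^1_0(\mathcal O)\cap H^2(\mathcal O)$, where $H^1_0(\mathcal O)$ is the closure of $C_c^\infty(\mathcal O)$ in $H^1(\mathcal O)$. For $u\in\mathcal V$ put $$\|u\|_{H^1_0}=\|\nabla u\|_{L^2(\mathcal O)},\qquad \|u\|_{H^2_0}=\|\Delta u\|_{L^2(\mathcal O)},\qquad \|u\|_{\mathcal V}=\Big(\|u\|_{L^2(\mathcal O)}^2+2\|\nabla u\|_{L^2(\mathcal O)}^2+\|\Delta u\|_{L^2(\mathcal O)}^2\Big)^{1/2},$$ and $$F(u)=\|u\|_{H^2_0}^2\,u+2\|u\|_{H^1_0}^2\,u+\|u\|_{L^{2n}(\mathcal O)}^{2n}\,u-u^{2n-1}.$$ Then $\mathcal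 V\subset L^{2n}(\mathcal O)$, $F$ is a well-defined map from $\mathcal V$ into $\mathcal H$, and $F$ is locally Lipschitz; that is, there is a constant $K$ (depending only on $d$, $\mathcal O$ and $n$) such that for all $u_1,u_2\in\mathcal V$ $$|F(u_1)-F(u_2)|_{\mathcal H}\le K\Big[\big(\|u_1\|_{\mathcal V}^2+\|u_2\|_{\mathcal V}^2+\|u_1\|_{\mathcal V}\|u_2\|_{\mathcal V}\big)+\big(\|u_1\|_{\mathcal V}^{2n-1}+\|u_2\|_{\mathcal V}^{2n-1}\big)\big(\|u_1\|_{\mathcal V}+\|u_2\|_{\mathcal V}\big)+\big(\|u_1\|_{\mathcal V}^{2n}+\|u_2\|_{\mathcal V}^{2n}\big)+\big(1+\|u_1\|_{\mathcal V}^2+\|u_2\|_{\mathcal V}^2\big)^{1/3}\Big]\|u_1-u_2\|_{\mathcal V}.$$ In particular, for every $R$ there is a constant $L$ such that $|F(u_1)-F(u_2)|_{\mathcal H}\le L\|u_1-u_2\|_{\mathcal V}$ whenever $\|u_1\|_{\mathcal V}\le R$ and $\|u_2\|_{\mathcal V}\le R$. -/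

import Mathlib

open MeasureTheory Set
open scoped ContDiff ENNReal

noncomputable section

namespace ConstrainedSH

/-- A bounded domain of `ℝ^d` with smooth boundary: near each boundary point, the domain is the
negativity set of a smooth function whose differential does not vanish at that point. -/
structure IsBoundedSmoothDomain {d : ℕ} (O : Set (EuclideanSpace ℝ (Fin d))) : Prop where
  isOpen : IsOpen O
  isConnected : IsConnected O
  isBounded : Bornology.IsBounded O
  smooth_boundary : ∀ x₀ ∈ frontier O, ∃ U : Set (EuclideanSpace ℝ (Fin d)),
    ∃ ρ : EuclideanSpace ℝ (Fin d) → ℝ,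
      IsOpen U ∧ x₀ ∈ U ∧ ContDiffOn ℝ ∞ ρ U ∧ fderiv ℝ ρ x₀ ≠ 0 ∧
        O ∩ U = {x ∈ U | ρ x < 0}

/-- The Hilbert space `H = L²(O)`. -/
abbrev L2 {d : ℕ} (O : Set (EuclideanSpace ℝ (Fin d))) : Type :=
  Lp ℝ 2 (volume.restrict O)

/-- Test functions: smooth functions with compact support contained in `O`. -/
structure IsTest {d : ℕ} (O : Set (EuclideanSpace ℝ (Fin d)))
    (φ : EuclideanSpace ℝ (Fin d) → ℝ) : Prop where
  contDiff : ContDiff ℝ ∞ φ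
  hasCompactSupport : HasCompactSupport φ
  tsupport_subset : tsupport φ ⊆ O

/-- The classical partial derivative `∂φ/∂xᵢ`. -/
def partialDeriv {d : ℕ} (i : Fin d) (φ : EuclideanSpace ℝ (Fin d) → ℝ)
    (x : EuclideanSpace ℝ (Fin d)) : ℝ :=
  fderiv ℝ φ x (EuclideanSpace.single i 1)

/-- `v ∈ L²(O)` is the weak partial derivative `Dᵢ u` of `u ∈ L²(O)`. -/
def HasWeakPartial {d : ℕ} (O : Set (EuclideanSpace ℝ (Fin d))) (i : Fin d) (u v : L2 O) : Prop :=
  ∀ φ : EuclideanSpace ℝ (Fin d) → ℝ, IsTest O φ →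
    (∫ x in O, u x * partialDeriv i φ x) = -(∫ x in O, v x * φ x)

/-- The Sobolev space `H²(O)`: all weak derivatives up to order two exist and lie in `L²(O)`. -/
def MemH2 {d : ℕ} (O : Set (EuclideanSpace ℝ (Fin d))) (u : L2 O) : Prop :=
  ∃ g : Fin d → L2 O, ∃ h : Fin d → Fin d → L2 O,
    (∀ i, HasWeakPartial O i u (g i)) ∧ ∀ i j, HasWeakPartial O j (g i) (h i j)

/-- The Sobolev space `H¹₀(O)`: the closure of the test functions in the `H¹(O)` norm. -/
def MemH10 {d : ℕ} (O : Set (EuclideanSpace ℝ (Fin d))) (u : L2 O) : Prop :=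
  ∃ g : Fin d → L2 O, (∀ i, HasWeakPartial O i u (g i)) ∧
    ∀ ε : ℝ≥0∞, 0 < ε → ∃ φ : EuclideanSpace ℝ (Fin d) → ℝ, IsTest O φ ∧
      eLpNorm (fun x => u x - φ x) 2 (volume.restrict O) < ε ∧
      ∀ i, eLpNorm (fun x => g i x - partialDeriv i φ x) 2 (volume.restrict O) < ε

section Helpers

variable {d : ℕ} {O : Set (EuclideanSpace ℝ (Fin d))}

theorem IsTest.differentiable {φ : EuclideanSpace ℝ (Fin d) → ℝ} (hφ : IsTest O φ) :
    Differentiable ℝ φ :=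
  hφ.contDiff.differentiable (by simp)

theorem IsTest.continuous_partialDeriv {φ : EuclideanSpace ℝ (Fin d) → ℝ} (hφ : IsTest O φ)
    (i : Fin d) : Continuous (partialDeriv i φ) :=
  (hφ.contDiff.continuous_fderiv (by simp)).clm_apply continuous_const

theorem IsTest.memLp {φ : EuclideanSpace ℝ (Fin d) → ℝ} (hφ : IsTest O φ) :
    MemLp φ 2 (volume.restrict O) :=
  (hφ.contDiff.continuous.memLp_of_hasCompactSupport hφ.hasCompactSupport).restrict O

theorem IsTest.memLp_partialDeriv {φ : EuclideanSpace ℝ (Fin d) → ℝ} (hφ : IsTest O φ)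
    (i : Fin d) : MemLp (partialDeriv i φ) 2 (volume.restrict O) :=
  ((hφ.continuous_partialDeriv i).memLp_of_hasCompactSupport
    (hφ.hasCompactSupport.fderiv_apply (𝕜 := ℝ) _)).restrict O

theorem isTest_zero : IsTest O (fun _ => (0 : ℝ)) where
  contDiff := contDiff_const
  hasCompactSupport := HasCompactSupport.zero
  tsupport_subset := by
    have h : tsupport (fun _ : EuclideanSpace ℝ (Fin d) => (0 : ℝ)) = ∅ :=
      tsupport_eq_empty_iff.2 rfl
    rw [h]
    exact empty_subset O

theorem IsTest.add {φ ψ : EuclideanSpace ℝ (Fin d) → ℝ} (hφ : IsTest O φ) (hψ : IsTest O ψ) :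
    IsTest O (fun x => φ x + ψ x) where
  contDiff := hφ.contDiff.add hψ.contDiff
  hasCompactSupport := hφ.hasCompactSupport.add hψ.hasCompactSupport
  tsupport_subset :=
    (tsupport_add φ ψ).trans (union_subset hφ.tsupport_subset hψ.tsupport_subset)

theorem IsTest.const_mul {φ : EuclideanSpace ℝ (Fin d) → ℝ} (c : ℝ) (hφ : IsTest O φ) :
    IsTest O (fun x => c * φ x) where
  contDiff := contDiff_const.mul hφ.contDiff
  hasCompactSupport := hφ.hasCompactSupport.mul_left (f := fun _ => c)
  tsupport_subset :=
    (tsupport_mul_subset_right (f := fun _ => c) (g := φ)).trans hφ.tsupport_subset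

theorem HasWeakPartial.zero (i : Fin d) : HasWeakPartial O i 0 0 := by
  intro φ _
  have h : ∀ f : EuclideanSpace ℝ (Fin d) → ℝ, (∫ x in O, (0 : L2 O) x * f x) = 0 := by
    intro f
    rw [← integral_zero (EuclideanSpace ℝ (Fin d)) ℝ (μ := volume.restrict O)]
    apply integral_congr_ae
    filter_upwards [Lp.coeFn_zero ℝ 2 (volume.restrict O)] with x hx
    rw [hx, Pi.zero_apply, zero_mul]
  rw [h, h, neg_zero]

theorem HasWeakPartial.add {i : Fin d} {u v u' v' : L2 O} (h : HasWeakPartial O i u v)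
    (h' : HasWeakPartial O i u' v') : HasWeakPartial O i (u + u') (v + v') := by
  intro φ hφ
  have key : ∀ (a b : L2 O) (f : EuclideanSpace ℝ (Fin d) → ℝ),
      MemLp f 2 (volume.restrict O) →
      (∫ x in O, (a + b) x * f x) = (∫ x in O, a x * f x) + (∫ x in O, b x * f x) := by
    intro a b f hf
    have ha : Integrable (fun x => a x * f x) (volume.restrict O) := (Lp.memLp a).integrable_mul hf
    have hb : Integrable (fun x => b x * f x) (volume.restrict O) := (Lp.memLp b).integrable_mul hf
    rw [← integral_add ha hb]
    apply integral_congr_ae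
    filter_upwards [Lp.coeFn_add a b] with x hx
    rw [hx, Pi.add_apply, add_mul]
  rw [key _ _ _ (hφ.memLp_partialDeriv i), key _ _ _ hφ.memLp, h φ hφ, h' φ hφ]
  ring

theorem HasWeakPartial.smul {i : Fin d} {u v : L2 O} (c : ℝ) (h : HasWeakPartial O i u v) :
    HasWeakPartial O i (c • u) (c • v) := by
  intro φ hφ
  have key : ∀ (a : L2 O) (f : EuclideanSpace ℝ (Fin d) → ℝ),
      (∫ x in O, (c • a) x * f x) = c * (∫ x in O, a x * f x) := by
    intro a f
    rw [← integral_const_mul]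
    apply integral_congr_ae
    filter_upwards [Lp.coeFn_smul c a] with x hx
    simp [hx, mul_assoc]
  rw [key, key, h φ hφ]
  ring

theorem MemH2.zero : MemH2 O 0 :=
  ⟨0, 0, fun i => HasWeakPartial.zero i, fun _ j => HasWeakPartial.zero j⟩

theorem MemH2.add {u v : L2 O} (hu : MemH2 O u) (hv : MemH2 O v) : MemH2 O (u + v) := by
  obtain ⟨g, h, hg, hh⟩ := hu
  obtain ⟨g', h', hg', hh'⟩ := hv
  exact ⟨g + g', h + h', fun i => (hg i).add (hg' i), fun i j => (hh i j).add (hh' i j)⟩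

theorem MemH2.smul {u : L2 O} (c : ℝ) (hu : MemH2 O u) : MemH2 O (c • u) := by
  obtain ⟨g, h, hg, hh⟩ := hu
  exact ⟨c • g, c • h, fun i => (hg i).smul c, fun i j => (hh i j).smul c⟩

theorem MemH10.zero : MemH10 O 0 := by
  have h0 : (fun x => (0 : L2 O) x - (0 : ℝ)) =ᵐ[volume.restrict O] 0 := by
    filter_upwards [Lp.coeFn_zero ℝ 2 (volume.restrict O)] with x hx
    rw [hx, sub_zero]
  refine ⟨0, fun i => HasWeakPartial.zero i, fun ε hε => ⟨_, isTest_zero, ?_, fun i => ?_⟩⟩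
  · rw [eLpNorm_congr_ae h0]
    simpa using hε
  · have h1 : (fun x => (0 : Fin d → L2 O) i x -
        partialDeriv i (fun _ : EuclideanSpace ℝ (Fin d) => (0 : ℝ)) x)
        = fun x => (0 : L2 O) x - (0 : ℝ) := by
      funext x
      simp [partialDeriv]
    rw [h1, eLpNorm_congr_ae h0]
    simpa using hε

theorem MemH10.add {u v : L2 O} (hu : MemH10 O u) (hv : MemH10 O v) : MemH10 O (u + v) := by
  obtain ⟨g, hg, hgε⟩ := hu
  obtain ⟨g', hg', hgε'⟩ := hv
  have key : ∀ (a b : L2 O) (f f' : EuclideanSpace ℝ (Fin d) → ℝ) (ε : ℝ≥0∞),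
      MemLp f 2 (volume.restrict O) → MemLp f' 2 (volume.restrict O) →
      eLpNorm (fun x => a x - f x) 2 (volume.restrict O) < ε / 2 →
      eLpNorm (fun x => b x - f' x) 2 (volume.restrict O) < ε / 2 →
      eLpNorm (fun x => (a + b) x - (f x + f' x)) 2 (volume.restrict O) < ε := by
    intro a b f f' ε hf hf' ha hb
    have e : (fun x => (a + b) x - (f x + f' x)) =ᵐ[volume.restrict O]
        (fun x => a x - f x) + (fun x => b x - f' x) := by
      filter_upwards [Lp.coeFn_add a b] with x hx
      simp only [hx, Pi.add_apply]
      ring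
    rw [eLpNorm_congr_ae e]
    refine (eLpNorm_add_le ((Lp.memLp a).sub hf).1 ((Lp.memLp b).sub hf').1
      (by norm_num)).trans_lt ?_
    rw [← ENNReal.add_halves ε]
    exact ENNReal.add_lt_add ha hb
  refine ⟨g + g', fun i => (hg i).add (hg' i), fun ε hε => ?_⟩
  obtain ⟨φ, hφ, h1, h2⟩ := hgε (ε / 2) (ENNReal.half_pos hε.ne')
  obtain ⟨ψ, hψ, h3, h4⟩ := hgε' (ε / 2) (ENNReal.half_pos hε.ne')
  refine ⟨_, hφ.add hψ, key _ _ _ _ _ hφ.memLp hψ.memLp h1 h3, fun i => ?_⟩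
  have e : partialDeriv i (fun x => φ x + ψ x)
      = fun x => partialDeriv i φ x + partialDeriv i ψ x := by
    funext x
    simp only [partialDeriv]
    rw [fderiv_fun_add (hφ.differentiable x) (hψ.differentiable x)]
    rfl
  rw [e]
  exact key _ _ _ _ _ (hφ.memLp_partialDeriv i) (hψ.memLp_partialDeriv i) (h2 i) (h4 i)

theorem MemH10.smul {u : L2 O} (c : ℝ) (hu : MemH10 O u) : MemH10 O (c • u) := by
  obtain ⟨g, hg, hgε⟩ := hu
  have key : ∀ (a : L2 O) (f : EuclideanSpace ℝ (Fin d) → ℝ) (ε : ℝ≥0∞), 0 < ε →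
      eLpNorm (fun x => a x - f x) 2 (volume.restrict O) < ε / (‖c‖ₑ + 1) →
      eLpNorm (fun x => (c • a) x - c * f x) 2 (volume.restrict O) < ε := by
    intro a f ε hε ha
    have e : (fun x => (c • a) x - c * f x) =ᵐ[volume.restrict O]
        c • (fun x => a x - f x) := by
      filter_upwards [Lp.coeFn_smul c a] with x hx
      simp [hx, mul_sub]
    rw [eLpNorm_congr_ae e, eLpNorm_const_smul]
    have hlt := (ENNReal.lt_div_iff_mul_lt (by simp) (by simp)).1 ha
    refine lt_of_le_of_lt ?_ hlt
    rw [mul_comm]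
    gcongr
    exact le_self_add
  refine ⟨c • g, fun i => (hg i).smul c, fun ε hε => ?_⟩
  obtain ⟨φ, hφ, h1, h2⟩ := hgε (ε / (‖c‖ₑ + 1)) (ENNReal.div_pos hε.ne' (by simp))
  refine ⟨_, hφ.const_mul c, key _ _ _ hε h1, fun i => ?_⟩
  have e : partialDeriv i (fun x => c * φ x) = fun x => c * partialDeriv i φ x := by
    funext x
    simp only [partialDeriv]
    rw [fderiv_const_mul (hφ.differentiable x)]
    rfl
  rw [e]
  exact key _ _ _ hε (h2 i)

end Helpers

/-- The space `V = H¹₀(O) ∩ H²(O)`, as a subspace of `L²(O)`. -/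
def V {d : ℕ} (O : Set (EuclideanSpace ℝ (Fin d))) : Submodule ℝ (L2 O) where
  carrier := {u | MemH10 O u ∧ MemH2 O u}
  zero_mem' := ⟨MemH10.zero, MemH2.zero⟩
  add_mem' := fun hu hv => ⟨hu.1.add hv.1, hu.2.add hv.2⟩
  smul_mem' := fun c _ hu => ⟨hu.1.smul c, hu.2.smul c⟩

open Classical in
/-- The weak partial derivative `Dᵢ u` in `L²(O)` (only meaningful when it exists; for open `O`
it is then unique). -/
def weakPartial {d : ℕ} (O : Set (EuclideanSpace ℝ (Fin d))) (i : Fin d) (u : L2 O) : L2 O :=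
  if h : ∃ v : L2 O, HasWeakPartial O i u v then h.choose else 0

/-- The weak Laplacian `Δu = ∑ᵢ Dᵢ Dᵢ u`. -/
def weakLaplacian {d : ℕ} (O : Set (EuclideanSpace ℝ (Fin d))) (u : L2 O) : L2 O :=
  ∑ i, weakPartial O i (weakPartial O i u)

/-- `‖u‖_{H¹₀} = ‖∇u‖_{L²}`. -/
def normH10 {d : ℕ} (O : Set (EuclideanSpace ℝ (Fin d))) (u : L2 O) : ℝ :=
  √(∑ i, ‖weakPartial O i u‖ ^ 2)

/-- `‖u‖_{H²₀} = ‖Δu‖_{L²}`. -/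
def normH20 {d : ℕ} (O : Set (EuclideanSpace ℝ (Fin d))) (u : L2 O) : ℝ :=
  ‖weakLaplacian O u‖

/-- `‖u‖_V = (‖u‖²_{L²} + 2 ‖∇u‖²_{L²} + ‖Δu‖²_{L²})^{1/2}`. -/
def normV {d : ℕ} (O : Set (EuclideanSpace ℝ (Fin d))) (u : L2 O) : ℝ :=
  √(‖u‖ ^ 2 + 2 * normH10 O u ^ 2 + normH20 O u ^ 2)

/-- `‖u‖_{L^p}` (finite exactly when `u ∈ L^p(O)`, otherwise the value is `0`). -/
def normLp {d : ℕ} (O : Set (EuclideanSpace ℝ (Fin d))) (p : ℝ) (u : L2 O) : ℝ :=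
  (eLpNorm u (ENNReal.ofReal p) (volume.restrict O)).toReal

/-- The odd power `s^{2n-1} = |s|^{2n-2} s`, for real `n ≥ 1`. -/
def oddPow (n s : ℝ) : ℝ := |s| ^ (2 * n - 2) * s

/-- For a positive integer `n`, the odd power is the usual power `s^{2n-1}`. -/
theorem oddPow_natCast (n : ℕ) (hn : 1 ≤ n) (s : ℝ) : oddPow n s = s ^ (2 * n - 1) := by
  obtain ⟨m, rfl⟩ := Nat.exists_eq_add_of_le' hn
  have h1 : (2 * ((m + 1 : ℕ) : ℝ) - 2) = ((2 * m : ℕ) : ℝ) := by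
    push_cast
    ring
  have h2 : 2 * (m + 1) - 1 = 2 * m + 1 := by omega
  rw [oddPow, h1, Real.rpow_natCast, h2, pow_succ, pow_mul, pow_mul, sq_abs]

/-- The function
`F(u) = ‖u‖²_{H²₀} u + 2 ‖u‖²_{H¹₀} u + ‖u‖^{2n}_{L^{2n}} u - u^{2n-1}` on `O`, pointwise. -/
def nonlinearity {d : ℕ} (O : Set (EuclideanSpace ℝ (Fin d))) (n : ℝ) (u : L2 O)
    (x : EuclideanSpace ℝ (Fin d)) : ℝ :=
  normH20 O u ^ 2 * u x + 2 * normH10 O u ^ 2 * u x + normLp O (2 * n) u ^ (2 * n) * u x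
    - oddPow n (u x)

end ConstrainedSH

end

noncomputable section

namespace ConstrainedSH

open scoped InnerProductSpace
open Filter Topology

/-! The heart is the embedding of `V O` into `L^p` for every finite `p` (`exists_eLpNorm_le_normV`),
with `normV` controlling only `u`, `∇u` and `Δu`. It is obtained by testing `Δu` against powers of
`u`, as in Moser iteration, instead of by bounding the full Hessian. Formally, testing with
`u^{4m+1}` bounds the energy of `w = u^{2m+1}` by a multiple of `‖Δu‖₂ ‖u^{4m+1}‖₂`. Since
`|u^{4m+1}| ≤ 1 + w²` and the Sobolev inequality bounds `‖w‖₄²` by the energy of `w`, this gives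
`‖w‖₄² ≤ a ‖Δu‖₂ (const + ‖w‖₄²)`. For small `normV O u` the last term is absorbed, and scaling
removes the smallness.

Such powers are not admissible as they stand, so they are replaced by `satPow ε` and `u` by nearby
test functions (`exists_isTest_satPow_bound`); Fatou's lemma then lets `ε → 0`
(`exists_eLpNorm_pow_le`).

Given the embedding, each summand of `F` is treated separately. The first three are scalars times
`u`, and the scalars are powers of seminorms dominated by `normV`. For the odd power, a pointwise
mean value estimate is combined with Hölder's inequality `L⁴ · L⁴ ⊂ L²`
(`exists_norm_oddPow_sub_le`). -/

variable {d : ℕ} {O : Set (EuclideanSpace ℝ (Fin d))}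

/-! ### Uniqueness and linearity of weak derivatives; the norms on `V` -/

theorem HasWeakPartial.unique (hO : IsOpen O) {i : Fin d} {u v w : L2 O}
    (hv : HasWeakPartial O i u v) (hw : HasWeakPartial O i u w) : v = w := by
  have hint : ∀ (a : L2 O) {φ : EuclideanSpace ℝ (Fin d) → ℝ}, IsTest O φ →
      Integrable (fun x => a x * φ x) (volume.restrict O) :=
    fun a φ hφ => (Lp.memLp a).integrable_mul hφ.memLp
  have hvw : MemLp (fun x => v x - w x) 2 (volume.restrict O) := (Lp.memLp v).sub (Lp.memLp w)
  have h := hO.ae_eq_zero_of_integral_contDiff_smul_eq_zero (μ := volume.restrict O)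
    (f := fun x => v x - w x)
    ((hvw.locallyIntegrable (by norm_num)).locallyIntegrableOn O) (fun φ h1 h2 h3 => by
      have hφ : IsTest O φ := ⟨h1, h2, h3⟩
      have e : ∀ x, φ x • (v x - w x) = v x * φ x - w x * φ x := fun x => by
        rw [smul_eq_mul]; ring
      simp_rw [e]
      rw [integral_sub (hint v hφ) (hint w hφ)]
      have e1 := hv φ hφ
      have e2 := hw φ hφ
      linarith)
  apply Lp.ext
  filter_upwards [h, ae_restrict_mem hO.measurableSet] with x hx hxO
  exact sub_eq_zero.1 (hx hxO)

/-- Uniqueness makes the choice in `weakPartial` harmless: any witness computes it. The linearity of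
the gradient and the Laplacian follows from this. -/
theorem HasWeakPartial.weakPartial_eq (hO : IsOpen O) {i : Fin d} {u v : L2 O}
    (hv : HasWeakPartial O i u v) : weakPartial O i u = v := by
  have h : ∃ v : L2 O, HasWeakPartial O i u v := ⟨v, hv⟩
  rw [weakPartial, dif_pos h]
  exact h.choose_spec.unique hO hv

theorem MemH2.hasWeakPartial (hO : IsOpen O) {u : L2 O} (hu : MemH2 O u) (i : Fin d) :
    HasWeakPartial O i u (weakPartial O i u) := by
  obtain ⟨g, h, hg, -⟩ := hu
  rw [(hg i).weakPartial_eq hO]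
  exact hg i

theorem MemH2.hasWeakPartial₂ (hO : IsOpen O) {u : L2 O} (hu : MemH2 O u) (i j : Fin d) :
    HasWeakPartial O j (weakPartial O i u) (weakPartial O j (weakPartial O i u)) := by
  obtain ⟨g, h, hg, hh⟩ := hu
  rw [(hg i).weakPartial_eq hO, (hh i j).weakPartial_eq hO]
  exact hh i j

theorem MemH2.weakPartial_smul (hO : IsOpen O) {u : L2 O} (hu : MemH2 O u) (c : ℝ) (i : Fin d) :
    weakPartial O i (c • u) = c • weakPartial O i u :=
  ((hu.hasWeakPartial hO i).smul c).weakPartial_eq hO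

theorem MemH2.weakPartial_add (hO : IsOpen O) {u v : L2 O} (hu : MemH2 O u) (hv : MemH2 O v)
    (i : Fin d) : weakPartial O i (u + v) = weakPartial O i u + weakPartial O i v :=
  ((hu.hasWeakPartial hO i).add (hv.hasWeakPartial hO i)).weakPartial_eq hO

theorem MemH2.weakLaplacian_smul (hO : IsOpen O) {u : L2 O} (hu : MemH2 O u) (c : ℝ) :
    weakLaplacian O (c • u) = c • weakLaplacian O u := by
  simp only [weakLaplacian, Finset.smul_sum]
  refine Finset.sum_congr rfl fun i _ => ?_
  rw [hu.weakPartial_smul hO]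
  exact ((hu.hasWeakPartial₂ hO i i).smul c).weakPartial_eq hO

theorem MemH2.weakLaplacian_add (hO : IsOpen O) {u v : L2 O} (hu : MemH2 O u) (hv : MemH2 O v) :
    weakLaplacian O (u + v) = weakLaplacian O u + weakLaplacian O v := by
  simp only [weakLaplacian, ← Finset.sum_add_distrib]
  refine Finset.sum_congr rfl fun i _ => ?_
  rw [hu.weakPartial_add hO hv]
  exact ((hu.hasWeakPartial₂ hO i i).add (hv.hasWeakPartial₂ hO i i)).weakPartial_eq hO

theorem MemH2.sub {u v : L2 O} (hu : MemH2 O u) (hv : MemH2 O v) : MemH2 O (u - v) := by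
  rw [sub_eq_add_neg, ← neg_one_smul ℝ v]
  exact hu.add (hv.smul _)

/-- The weak gradient as an element of the Hilbert space `L²(O)^d`. -/
def weakGrad (O : Set (EuclideanSpace ℝ (Fin d))) (u : L2 O) : PiLp 2 (fun _ : Fin d => L2 O) :=
  WithLp.toLp 2 fun i => weakPartial O i u

theorem normH10_eq (u : L2 O) : normH10 O u = ‖weakGrad O u‖ := by
  rw [PiLp.norm_eq_of_L2]
  rfl

theorem MemH2.weakGrad_add (hO : IsOpen O) {u v : L2 O} (hu : MemH2 O u) (hv : MemH2 O v) :
    weakGrad O (u + v) = weakGrad O u + weakGrad O v := by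
  ext1 i
  exact hu.weakPartial_add hO hv i

theorem MemH2.weakGrad_smul (hO : IsOpen O) {u : L2 O} (hu : MemH2 O u) (c : ℝ) :
    weakGrad O (c • u) = c • weakGrad O u := by
  ext1 i
  exact hu.weakPartial_smul hO c i

theorem MemH2.abs_normH10_sub_le (hO : IsOpen O) {u v : L2 O} (hu : MemH2 O u)
    (hv : MemH2 O v) : |normH10 O u - normH10 O v| ≤ normH10 O (u - v) := by
  have h := (hu.sub hv).weakGrad_add hO hv
  rw [sub_add_cancel] at h
  rw [normH10_eq, normH10_eq, normH10_eq, eq_sub_of_add_eq h.symm]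
  exact abs_norm_sub_norm_le _ _

theorem MemH2.abs_normH20_sub_le (hO : IsOpen O) {u v : L2 O} (hu : MemH2 O u)
    (hv : MemH2 O v) : |normH20 O u - normH20 O v| ≤ normH20 O (u - v) := by
  have h := (hu.sub hv).weakLaplacian_add hO hv
  rw [sub_add_cancel] at h
  rw [normH20, normH20, normH20, eq_sub_of_add_eq h.symm]
  exact abs_norm_sub_norm_le _ _

theorem normV_nonneg (u : L2 O) : 0 ≤ normV O u := Real.sqrt_nonneg _

theorem normH10_nonneg (u : L2 O) : 0 ≤ normH10 O u := Real.sqrt_nonneg _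

theorem normH20_nonneg (u : L2 O) : 0 ≤ normH20 O u := norm_nonneg _

theorem norm_le_normV (u : L2 O) : ‖u‖ ≤ normV O u :=
  Real.le_sqrt_of_sq_le (by nlinarith [sq_nonneg (normH10 O u), sq_nonneg (normH20 O u)])

theorem normH10_le_normV (u : L2 O) : normH10 O u ≤ normV O u :=
  Real.le_sqrt_of_sq_le (by
    nlinarith [sq_nonneg (normH10 O u), sq_nonneg (normH20 O u), sq_nonneg ‖u‖])

theorem normH20_le_normV (u : L2 O) : normH20 O u ≤ normV O u :=
  Real.le_sqrt_of_sq_le (by nlinarith [sq_nonneg (normH10 O u), sq_nonneg ‖u‖])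

theorem MemH2.normV_smul (hO : IsOpen O) {u : L2 O} (hu : MemH2 O u) (c : ℝ) :
    normV O (c • u) = |c| * normV O u := by
  rw [normV, normV, normH10_eq, normH10_eq, normH20, normH20, hu.weakGrad_smul hO,
    hu.weakLaplacian_smul hO, norm_smul, norm_smul, norm_smul, Real.norm_eq_abs,
    ← Real.sqrt_sq (abs_nonneg c), ← Real.sqrt_mul (sq_nonneg _), Real.sqrt_sq (abs_nonneg c)]
  congr 1
  ring

/-! ### Pairing with test functions and the Sobolev inequality -/

/-- A test function as an element of `L²(O)`. -/
def IsTest.toL2 {φ : EuclideanSpace ℝ (Fin d) → ℝ} (hφ : IsTest O φ) : L2 O :=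
  hφ.memLp.toLp φ

/-- A partial derivative of a test function as an element of `L²(O)`. -/
def IsTest.partialL2 {φ : EuclideanSpace ℝ (Fin d) → ℝ} (hφ : IsTest O φ) (i : Fin d) : L2 O :=
  (hφ.memLp_partialDeriv i).toLp _

theorem HasWeakPartial.inner_eq {i : Fin d} {u v : L2 O} (h : HasWeakPartial O i u v)
    {φ : EuclideanSpace ℝ (Fin d) → ℝ} (hφ : IsTest O φ) :
    ⟪u, hφ.partialL2 i⟫_ℝ = -⟪v, hφ.toL2⟫_ℝ := by
  have key : ∀ (a : L2 O) {f : EuclideanSpace ℝ (Fin d) → ℝ}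
      (hf : MemLp f 2 (volume.restrict O)), ⟪a, hf.toLp f⟫_ℝ = ∫ x in O, a x * f x := by
    intro a f hf
    rw [L2.inner_def]
    apply integral_congr_ae
    filter_upwards [hf.coeFn_toLp] with x hx
    rw [hx, RCLike.inner_apply, conj_trivial, mul_comm]
  rw [IsTest.partialL2, IsTest.toL2, key, key]
  exact h φ hφ

/-- Elements of `V` satisfy the weak form of the Poisson equation. -/
theorem MemH2.sum_inner_weakPartial (hO : IsOpen O) {u : L2 O} (hu : MemH2 O u)
    {φ : EuclideanSpace ℝ (Fin d) → ℝ} (hφ : IsTest O φ) :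
    ∑ i, ⟪weakPartial O i u, hφ.partialL2 i⟫_ℝ = -⟪weakLaplacian O u, hφ.toL2⟫_ℝ := by
  rw [weakLaplacian, sum_inner, ← Finset.sum_neg_distrib]
  exact Finset.sum_congr rfl fun i _ => (hu.hasWeakPartial₂ hO i i).inner_eq hφ

/-- Approximation of an element of `V` by test functions in the `H¹` norm. -/
theorem MemH10.exists_isTest (hO : IsOpen O) {u : L2 O} (hu : MemH10 O u) {ε : ℝ} (hε : 0 < ε) :
    ∃ φ : EuclideanSpace ℝ (Fin d) → ℝ, ∃ hφ : IsTest O φ, ‖u - hφ.toL2‖ < ε ∧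
      ∀ i, ‖weakPartial O i u - hφ.partialL2 i‖ < ε := by
  have key : ∀ (a : L2 O) {f : EuclideanSpace ℝ (Fin d) → ℝ}
      (hf : MemLp f 2 (volume.restrict O)),
      eLpNorm (fun x => a x - f x) 2 (volume.restrict O) < ENNReal.ofReal ε →
        ‖a - hf.toLp f‖ < ε := by
    intro a f hf h
    rw [Lp.norm_def]
    refine (ENNReal.toReal_lt_of_lt_ofReal ?_)
    refine lt_of_eq_of_lt (eLpNorm_congr_ae ?_) h
    filter_upwards [Lp.coeFn_sub a (hf.toLp f), hf.coeFn_toLp] with x hx hx'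
    rw [hx, Pi.sub_apply, hx']
  obtain ⟨g, hg, hgε⟩ := hu
  obtain ⟨φ, hφ, h1, h2⟩ := hgε (ENNReal.ofReal ε) (ENNReal.ofReal_pos.2 hε)
  refine ⟨φ, hφ, key _ _ h1, fun i => ?_⟩
  rw [(hg i).weakPartial_eq hO]
  exact key _ _ (h2 i)

theorem IsTest.norm_partialL2 {φ : EuclideanSpace ℝ (Fin d) → ℝ} (hφ : IsTest O φ) (i : Fin d) :
    ‖hφ.partialL2 i‖ = (eLpNorm (partialDeriv i φ) 2 (volume.restrict O)).toReal := by
  rw [IsTest.partialL2, Lp.norm_toLp]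

theorem norm_fderiv_le_sum_partialDeriv (φ : EuclideanSpace ℝ (Fin d) → ℝ)
    (x : EuclideanSpace ℝ (Fin d)) : ‖fderiv ℝ φ x‖ ≤ ∑ i, |partialDeriv i φ x| := by
  refine ContinuousLinearMap.opNorm_le_bound _ (Finset.sum_nonneg fun _ _ => abs_nonneg _)
    fun v => ?_
  have hv : v = ∑ i, v i • EuclideanSpace.single i (1 : ℝ) := by
    ext j
    simp [Pi.single_apply]
  have h : fderiv ℝ φ x v = ∑ i, v i * partialDeriv i φ x := by
    conv_lhs => rw [hv]
    rw [map_sum]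
    simp [partialDeriv]
  rw [h, Finset.sum_mul]
  refine (norm_sum_le _ _).trans (Finset.sum_le_sum fun i _ => ?_)
  rw [norm_mul, mul_comm, Real.norm_eq_abs]
  exact mul_le_mul_of_nonneg_left (PiLp.norm_apply_le v i) (abs_nonneg _)

/-- A Sobolev inequality in dimensions two and three. -/
theorem exists_sobolev_const (hd : d = 2 ∨ d = 3) (hb : Bornology.IsBounded O) :
    ∃ S : ℝ, 0 ≤ S ∧ ∀ (φ : EuclideanSpace ℝ (Fin d) → ℝ) (hφ : IsTest O φ),
      (eLpNorm φ 4 (volume.restrict O)).toReal ^ 2 ≤ S * ∑ i, ‖hφ.partialL2 i‖ ^ 2 := by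
  obtain ⟨p, hp1, hp2, hpd, hp4⟩ : ∃ p : NNReal, 1 ≤ p ∧ p ≤ 2 ∧ p < (d : NNReal) ∧
      ((p⁻¹ : NNReal) : ℝ) - (d : ℝ)⁻¹ ≤ ((4 : NNReal) : ℝ)⁻¹ := by
    -- The Sobolev inequality needs `p < d`, which excludes `p = 2` when `d = 2`; reaching `L⁴` when
    -- `d = 3` needs `p ≥ 12/7`. The value `7/4` serves both dimensions, and Hölder on the bounded
    -- set `O` passes from `L^p` to `L²`.
    refine ⟨7 / 4, by rw [one_le_div₀] <;> norm_num, by rw [div_le_iff₀] <;> norm_num, ?_, ?_⟩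
    · rw [div_lt_iff₀ (by norm_num)]
      rcases hd with rfl | rfl <;> norm_num
    · rcases hd with rfl | rfl <;> push_cast <;> norm_num
  set c : ℝ≥0∞ := (eLpNormLESNormFDerivOfLeConst ℝ
    (volume : Measure (EuclideanSpace ℝ (Fin d))) O p 4 : ℝ≥0∞) *
    (volume.restrict O univ) ^ (1 / (p : ℝ≥0∞).toReal - 1 / (2 : ℝ≥0∞).toReal) with hc
  have hvol : volume.restrict O univ ≠ ⊤ := by
    rw [Measure.restrict_apply_univ]
    exact hb.measure_lt_top.ne
  have hctop : c ≠ ⊤ := ENNReal.mul_ne_top ENNReal.coe_ne_top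
    (ENNReal.rpow_ne_top_of_nonneg (sub_nonneg.2 (one_div_le_one_div_of_le (by
      simpa using zero_lt_one.trans_le hp1) (by
        exact_mod_cast hp2))) hvol)
  refine ⟨c.toReal ^ 2 * d, by positivity, fun φ hφ => ?_⟩
  have h1 : eLpNorm φ 4 (volume.restrict O) ≤
      c * ∑ i, eLpNorm (partialDeriv i φ) 2 (volume.restrict O) := by
    have hφ1 : ContDiff ℝ 1 φ := hφ.contDiff.of_le (by simp)
    have hsob := eLpNorm_le_eLpNorm_fderiv_of_le
      (volume : Measure (EuclideanSpace ℝ (Fin d))) hφ1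
      ((subset_tsupport φ).trans hφ.tsupport_subset) (p := p) (q := 4) hp1
      (by rwa [finrank_euclideanSpace_fin]) (by rwa [finrank_euclideanSpace_fin]) hb
    rw [ENNReal.coe_ofNat] at hsob
    have hcont : Continuous fun x => ‖fderiv ℝ φ x‖ :=
      (hφ.contDiff.continuous_fderiv (by simp)).norm
    have hp2' : (p : ℝ≥0∞) ≤ 2 := by exact_mod_cast hp2
    -- The Sobolev inequality is global; the derivative vanishes off `O`, so its norm over the whole
    -- space is its norm over `O`.
    have hsupp : Function.support (fun x => ‖fderiv ℝ φ x‖) ⊆ O := fun x hx =>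
      hφ.tsupport_subset (support_fderiv_subset ℝ (norm_ne_zero_iff.1 hx))
    have hres : eLpNorm (fderiv ℝ φ) p volume =
        eLpNorm (fun x => ‖fderiv ℝ φ x‖) p (volume.restrict O) := by
      rw [eLpNorm_restrict_eq_of_support_subset hsupp, eLpNorm_norm]
    have hholder := eLpNorm_le_eLpNorm_mul_rpow_measure_univ (μ := volume.restrict O) hp2'
      hcont.aestronglyMeasurable
    have hsum : eLpNorm (fun x => ‖fderiv ℝ φ x‖) 2 (volume.restrict O) ≤
        ∑ i, eLpNorm (partialDeriv i φ) 2 (volume.restrict O) := by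
      have hm : ∀ i, AEStronglyMeasurable (fun x => |partialDeriv i φ x|) (volume.restrict O) :=
        fun i => (hφ.continuous_partialDeriv i).abs.aestronglyMeasurable
      refine (eLpNorm_mono_real (g := fun x => ∑ i, |partialDeriv i φ x|)
        fun x => (norm_norm _).trans_le (norm_fderiv_le_sum_partialDeriv φ x)).trans ?_
      have e : (fun x => ∑ i, |partialDeriv i φ x|) = ∑ i, fun x => |partialDeriv i φ x| := by
        funext x
        simp
      rw [e]
      refine (eLpNorm_sum_le (fun i _ => hm i) (by norm_num)).trans (le_of_eq ?_)
      exact Finset.sum_congr rfl fun i _ => eLpNorm_norm (partialDeriv i φ)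
    calc eLpNorm φ 4 (volume.restrict O) ≤ eLpNorm φ 4 volume :=
          eLpNorm_mono_measure _ Measure.restrict_le_self
      _ ≤ _ := hsob
      _ ≤ _ * ((∑ i, eLpNorm (partialDeriv i φ) 2 (volume.restrict O)) *
          (volume.restrict O univ) ^ (1 / (p : ℝ≥0∞).toReal - 1 / (2 : ℝ≥0∞).toReal)) := by
          rw [hres]
          gcongr
          exact hholder.trans (mul_le_mul' hsum le_rfl)
      _ = _ := by rw [hc]; ring
  have hfin : ∀ i, eLpNorm (partialDeriv i φ) 2 (volume.restrict O) ≠ ⊤ :=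
    fun i => (hφ.memLp_partialDeriv i).2.ne
  have h2 : (eLpNorm φ 4 (volume.restrict O)).toReal ≤ c.toReal * ∑ i, ‖hφ.partialL2 i‖ := by
    refine (ENNReal.toReal_mono (ENNReal.mul_ne_top hctop
      (ENNReal.sum_ne_top.2 fun i _ => hfin i)) h1).trans (le_of_eq ?_)
    rw [ENNReal.toReal_mul, ENNReal.toReal_sum fun i _ => hfin i]
    simp_rw [hφ.norm_partialL2]
  calc (eLpNorm φ 4 (volume.restrict O)).toReal ^ 2 ≤ (c.toReal * ∑ i, ‖hφ.partialL2 i‖) ^ 2 :=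
        pow_le_pow_left₀ ENNReal.toReal_nonneg h2 2
    _ = c.toReal ^ 2 * (∑ i, ‖hφ.partialL2 i‖) ^ 2 := by ring
    _ ≤ c.toReal ^ 2 * (d * ∑ i, ‖hφ.partialL2 i‖ ^ 2) := by
        gcongr
        simpa using sq_sum_le_card_mul_sum_sq (s := Finset.univ) (f := fun i => ‖hφ.partialL2 i‖)
    _ = _ := by ring

/-! ### Truncated odd powers -/

/-- A smooth function of linear growth approximating the odd power `s ^ (2 m + 1)`. -/
def satPow (ε : ℝ) (m : ℕ) (s : ℝ) : ℝ := s * (s ^ 2 / (1 + ε * s ^ 2)) ^ m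

section SatPow

variable {ε : ℝ}

theorem one_add_mul_sq_pos (hε : 0 < ε) (s : ℝ) : 0 < 1 + ε * s ^ 2 := by positivity

theorem contDiff_satPow (hε : 0 < ε) (m : ℕ) : ContDiff ℝ ∞ (satPow ε m) :=
  contDiff_id.mul (((contDiff_id.pow 2).div (contDiff_const.add (contDiff_const.mul
    (contDiff_id.pow 2))) fun s => (one_add_mul_sq_pos hε s).ne').pow m)

theorem satPow_zero (m : ℕ) : satPow ε m 0 = 0 := zero_mul _

theorem deriv_satPow (hε : 0 < ε) (m : ℕ) (s : ℝ) :
    deriv (satPow ε m) s =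
      (s ^ 2 / (1 + ε * s ^ 2)) ^ m * (1 + 2 * m / (1 + ε * s ^ 2)) := by
  have hne := (one_add_mul_sq_pos hε s).ne'
  have h1 : HasDerivAt (fun s : ℝ => s ^ 2) (2 * s) s := by simpa using hasDerivAt_pow 2 s
  have h2 : HasDerivAt (fun s : ℝ => 1 + ε * s ^ 2) (ε * (2 * s)) s :=
    (h1.const_mul ε).const_add 1
  have h := (hasDerivAt_id s).mul ((h1.div h2 hne).pow m)
  refine (h.deriv : deriv (satPow ε m) s = _).trans ?_
  -- The power rule contains the truncated exponent `m - 1`, so `m = 0` is separate.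
  rcases m with _ | m
  · simp
  · simp only [id, Pi.pow_apply, Pi.div_apply, Nat.add_sub_cancel]
    push_cast
    rw [pow_succ]
    field_simp
    ring

theorem deriv_satPow_nonneg (hε : 0 < ε) (m : ℕ) (s : ℝ) : 0 ≤ deriv (satPow ε m) s := by
  rw [deriv_satPow hε]
  have := one_add_mul_sq_pos hε s
  positivity

theorem deriv_satPow_le (hε : 0 < ε) (m : ℕ) (s : ℝ) :
    deriv (satPow ε m) s ≤ (1 / ε) ^ m * (1 + 2 * m) := by
  have h := one_add_mul_sq_pos hε s
  have h1 : s ^ 2 / (1 + ε * s ^ 2) ≤ 1 / ε := by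
    rw [div_le_div_iff₀ h hε]
    nlinarith
  have h2 : 2 * (m : ℝ) / (1 + ε * s ^ 2) ≤ 2 * m :=
    div_le_self (by positivity) (by nlinarith [sq_nonneg s])
  rw [deriv_satPow hε]
  exact mul_le_mul (pow_le_pow_left₀ (by positivity) h1 m) (by linarith) (by positivity)
    (by positivity)

/-- Both sides carry the factor `(s² / (1 + ε s²))^{2m}`, and the remaining factor of each
derivative is at least `1`, the one on the left being at most `1 + 2m`. This is the truncated form
of the comparison of `((s^{2m+1})')²` with `(s^{4m+1})'`. -/
theorem sq_deriv_satPow_le (hε : 0 < ε) (m : ℕ) (s : ℝ) :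
    deriv (satPow ε m) s ^ 2 ≤ (1 + 2 * m) ^ 2 * deriv (satPow ε (2 * m)) s := by
  have h := one_add_mul_sq_pos hε s
  rw [deriv_satPow hε, deriv_satPow hε, mul_pow, ← pow_mul, mul_comm m 2, mul_comm]
  have h1 : 1 + 2 * (m : ℝ) / (1 + ε * s ^ 2) ≤ 1 + 2 * m := by
    gcongr
    exact div_le_self (by positivity) (by nlinarith [sq_nonneg s])
  have h2 : (1 : ℝ) ≤ 1 + 2 * (2 * m : ℕ) / (1 + ε * s ^ 2) := by
    have : 0 ≤ 2 * ((2 * m : ℕ) : ℝ) / (1 + ε * s ^ 2) := by positivity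
    linarith
  have h3 : 0 ≤ (s ^ 2 / (1 + ε * s ^ 2)) ^ (2 * m) := by positivity
  have h4 : 0 ≤ 2 * (m : ℝ) / (1 + ε * s ^ 2) := by positivity
  refine mul_le_mul (pow_le_pow_left₀ (by linarith) h1 2) ?_ h3 (by positivity)
  exact le_mul_of_one_le_right h3 h2

/-- The square on the right has one extra factor `|s|`: it helps when `|s| ≥ 1`, and when `|s| ≤ 1`
the left side is at most `1`. -/
theorem abs_satPow_two_mul_le (hε : 0 < ε) (m : ℕ) (s : ℝ) :
    |satPow ε (2 * m) s| ≤ 1 + satPow ε m s ^ 2 := by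
  have h := one_add_mul_sq_pos hε s
  set A := s ^ 2 / (1 + ε * s ^ 2) with hA
  have hA0 : 0 ≤ A := by positivity
  have e1 : |satPow ε (2 * m) s| = |s| * A ^ (2 * m) := by
    rw [satPow, abs_mul, abs_of_nonneg (pow_nonneg hA0 _)]
  have e2 : satPow ε m s ^ 2 = |s| * (|s| * A ^ (2 * m)) := by
    rw [satPow, ← hA, mul_pow, ← pow_mul, mul_comm m 2, ← sq_abs s]
    ring
  have h0 : 0 ≤ |s| * A ^ (2 * m) := by positivity
  rw [e1, e2]
  rcases le_total 1 |s| with hs | hs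
  · nlinarith
  · have hA1 : A ≤ 1 := by
      rw [hA, div_le_one h]
      have : s ^ 2 ≤ 1 := by rw [← sq_abs]; exact pow_le_one₀ (abs_nonneg _) hs
      nlinarith [sq_nonneg s]
    have : |s| * A ^ (2 * m) ≤ 1 :=
      mul_le_one₀ hs (by positivity) (pow_le_one₀ hA0 hA1)
    nlinarith [mul_nonneg (abs_nonneg s) h0]

/-- Convergence is joint in the truncation parameter and the argument, so a single sequence can
remove the truncation and approximate `u` at once. -/
theorem tendsto_satPow {ι : Type*} {l : Filter ι} {e a : ι → ℝ} {s : ℝ} (m : ℕ)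
    (he : Tendsto e l (𝓝 0)) (ha : Tendsto a l (𝓝 s)) :
    Tendsto (fun j => satPow (e j) m (a j)) l (𝓝 (s ^ (2 * m + 1))) := by
  have h1 : Tendsto (fun j => 1 + e j * a j ^ 2) l (𝓝 (1 + 0 * s ^ 2)) :=
    (he.mul (ha.pow 2)).const_add 1
  have h2 := ha.mul (((ha.pow 2).div h1 (by simp)).pow m)
  rw [zero_mul, add_zero, div_one, ← pow_mul, mul_comm s, ← pow_succ] at h2
  exact h2

end SatPow

/-! ### Truncated powers of test functions -/

theorem IsTest.comp {φ : EuclideanSpace ℝ (Fin d) → ℝ} (hφ : IsTest O φ) {g : ℝ → ℝ}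
    (hg : ContDiff ℝ ∞ g) (hg0 : g 0 = 0) : IsTest O (fun x => g (φ x)) where
  contDiff := hg.comp hφ.contDiff
  hasCompactSupport := hφ.hasCompactSupport.comp_left hg0
  tsupport_subset := (closure_mono (Function.support_comp_subset hg0 φ)).trans hφ.tsupport_subset

theorem IsTest.partialDeriv_comp {φ : EuclideanSpace ℝ (Fin d) → ℝ} (hφ : IsTest O φ) {g : ℝ → ℝ}
    (hg : ContDiff ℝ ∞ g) (i : Fin d) (x : EuclideanSpace ℝ (Fin d)) :
    partialDeriv i (fun x => g (φ x)) x = deriv g (φ x) * partialDeriv i φ x := by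
  have h := ((hg.differentiable (by simp) (φ x)).hasDerivAt.comp_hasFDerivAt x
    (hφ.differentiable x).hasFDerivAt).fderiv
  have h' : fderiv ℝ (fun x => g (φ x)) x = deriv g (φ x) • fderiv ℝ φ x := h
  simp [partialDeriv, h']

theorem IsTest.inner_partialL2 {φ ψ : EuclideanSpace ℝ (Fin d) → ℝ} (hφ : IsTest O φ)
    (hψ : IsTest O ψ) (i : Fin d) :
    ⟪hφ.partialL2 i, hψ.partialL2 i⟫_ℝ = ∫ x in O, partialDeriv i φ x * partialDeriv i ψ x := by
  rw [L2.inner_def]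
  apply integral_congr_ae
  filter_upwards [(hφ.memLp_partialDeriv i).coeFn_toLp, (hψ.memLp_partialDeriv i).coeFn_toLp]
    with x hx hx'
  rw [IsTest.partialL2, IsTest.partialL2, hx, hx', RCLike.inner_apply, conj_trivial, mul_comm]

theorem IsTest.integrable_partialDeriv_mul {φ ψ : EuclideanSpace ℝ (Fin d) → ℝ}
    (hφ : IsTest O φ) (hψ : IsTest O ψ) (i : Fin d) :
    Integrable (fun x => partialDeriv i φ x * partialDeriv i ψ x) (volume.restrict O) :=
  (hφ.memLp_partialDeriv i).integrable_mul (hψ.memLp_partialDeriv i)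

theorem IsTest.satPow {ε : ℝ} (hε : 0 < ε) (m : ℕ) {φ : EuclideanSpace ℝ (Fin d) → ℝ}
    (hφ : IsTest O φ) : IsTest O (fun x => satPow ε m (φ x)) :=
  hφ.comp (contDiff_satPow hε m) (satPow_zero m)

/-- The energy of `satPow ε m ∘ φ` is controlled by testing against `satPow ε (2 * m) ∘ φ`. -/
theorem IsTest.norm_partialL2_satPow_sq_le {ε : ℝ} (hε : 0 < ε) (m : ℕ)
    {φ : EuclideanSpace ℝ (Fin d) → ℝ} (hφ : IsTest O φ) (i : Fin d) :
    ‖(hφ.satPow hε m).partialL2 i‖ ^ 2 ≤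
      (1 + 2 * m) ^ 2 * ⟪hφ.partialL2 i, (hφ.satPow hε (2 * m)).partialL2 i⟫_ℝ := by
  rw [← real_inner_self_eq_norm_sq, IsTest.inner_partialL2, IsTest.inner_partialL2,
    ← integral_const_mul]
  refine integral_mono ((hφ.satPow hε m).integrable_partialDeriv_mul (hφ.satPow hε m) i)
    ((hφ.integrable_partialDeriv_mul (hφ.satPow hε (2 * m)) i).const_mul _) fun x => ?_
  simp only [hφ.partialDeriv_comp (contDiff_satPow hε _)]
  nlinarith [mul_le_mul_of_nonneg_right (sq_deriv_satPow_le hε m (φ x))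
    (sq_nonneg (partialDeriv i φ x))]

/-- The constant blows up as `ε → 0`. It only multiplies the error of approximating `u` by `φ`,
which can be chosen small after `ε`. -/
theorem IsTest.norm_partialL2_satPow_le {ε : ℝ} (hε : 0 < ε) (m : ℕ)
    {φ : EuclideanSpace ℝ (Fin d) → ℝ} (hφ : IsTest O φ) (i : Fin d) :
    ‖(hφ.satPow hε m).partialL2 i‖ ≤ (1 / ε) ^ m * (1 + 2 * m) * ‖hφ.partialL2 i‖ := by
  refine Lp.norm_le_mul_norm_of_ae_le_mul ?_
  filter_upwards [(hφ.memLp_partialDeriv i).coeFn_toLp,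
    ((hφ.satPow hε m).memLp_partialDeriv i).coeFn_toLp] with x hx hx'
  rw [IsTest.partialL2, IsTest.partialL2, hx, hx',
    hφ.partialDeriv_comp (contDiff_satPow hε _), norm_mul, Real.norm_eq_abs (deriv _ _),
    abs_of_nonneg (deriv_satPow_nonneg hε m _)]
  exact mul_le_mul_of_nonneg_right (deriv_satPow_le hε m _) (norm_nonneg _)

theorem IsTest.memLp_four {φ : EuclideanSpace ℝ (Fin d) → ℝ} (hφ : IsTest O φ) :
    MemLp φ 4 (volume.restrict O) :=
  (hφ.contDiff.continuous.memLp_of_hasCompactSupport hφ.hasCompactSupport).restrict O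

theorem memLp_one_of_isBounded (hb : Bornology.IsBounded O) (p : ℝ≥0∞) :
    MemLp (fun _ : EuclideanSpace ℝ (Fin d) => (1 : ℝ)) p (volume.restrict O) := by
  have : IsFiniteMeasure (volume.restrict O) := isFiniteMeasure_restrict.2 hb.measure_lt_top.ne
  exact memLp_const 1

/-- This closes the loop: the function tested against `Δu` is controlled by the same `L⁴` quantity
that the Sobolev inequality bounds, with constants free of `ε`. It integrates
`abs_satPow_two_mul_le`, using `‖H²‖₂ = ‖H‖₄²`. -/
theorem IsTest.norm_toL2_satPow_le (hb : Bornology.IsBounded O) {ε : ℝ} (hε : 0 < ε) (m : ℕ)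
    {φ : EuclideanSpace ℝ (Fin d) → ℝ} (hφ : IsTest O φ) :
    ‖(hφ.satPow hε (2 * m)).toL2‖ ≤
      (eLpNorm (fun _ : EuclideanSpace ℝ (Fin d) => (1 : ℝ)) 2 (volume.restrict O)).toReal +
        (eLpNorm (fun x => ConstrainedSH.satPow ε m (φ x)) 4 (volume.restrict O)).toReal ^ 2 := by
  set H : EuclideanSpace ℝ (Fin d) → ℝ := fun x => ConstrainedSH.satPow ε m (φ x) with hH
  have hHt : IsTest O H := hφ.satPow hε m
  have h1 := (memLp_one_of_isBounded hb 2).2.ne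
  have h4 := hHt.memLp_four.2.ne
  have e : eLpNorm (fun x => ‖H x‖ ^ (2 : ℝ)) 2 (volume.restrict O) =
      eLpNorm H 4 (volume.restrict O) ^ (2 : ℝ) := by
    rw [eLpNorm_norm_rpow H (by norm_num)]
    congr 2
    rw [ENNReal.ofReal_ofNat]
    norm_num
  have hle : eLpNorm (fun x => ConstrainedSH.satPow ε (2 * m) (φ x)) 2 (volume.restrict O) ≤
      eLpNorm (fun _ : EuclideanSpace ℝ (Fin d) => (1 : ℝ)) 2 (volume.restrict O) +
        eLpNorm H 4 (volume.restrict O) ^ (2 : ℝ) := by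
    rw [← e]
    refine le_trans (eLpNorm_mono_real fun x => ?_) (eLpNorm_add_le
      aestronglyMeasurable_const ?_ (by norm_num))
    · rw [Pi.add_apply, Real.rpow_two, Real.norm_eq_abs, Real.norm_eq_abs, sq_abs]
      exact abs_satPow_two_mul_le hε m (φ x)
    · have : Continuous fun x => ‖H x‖ ^ (2 : ℝ) := by
        simp_rw [Real.rpow_two]
        exact hHt.contDiff.continuous.norm.pow 2
      exact this.aestronglyMeasurable
  rw [IsTest.toL2, Lp.norm_toLp]
  refine (ENNReal.toReal_mono (ENNReal.add_ne_top.2 ⟨h1, ?_⟩) hle).trans (le_of_eq ?_)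
  · exact ENNReal.rpow_ne_top_of_nonneg (by norm_num) h4
  · rw [ENNReal.toReal_add h1 (ENNReal.rpow_ne_top_of_nonneg (by norm_num) h4),
      ← ENNReal.toReal_rpow, Real.rpow_two]

theorem norm_weakPartial_le_normV (u : L2 O) (i : Fin d) : ‖weakPartial O i u‖ ≤ normV O u :=
  ((PiLp.norm_apply_le (weakGrad O u) i).trans (normH10_eq u).ge).trans (normH10_le_normV u)

/-! ### The embedding of `V` into every `L^p` -/

/-- Test functions close to a small element of `V` satisfy a uniform truncated power bound. -/
theorem exists_isTest_satPow_bound (hd : d = 2 ∨ d = 3) (hO : IsOpen O)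
    (hb : Bornology.IsBounded O) (m : ℕ) :
    ∃ C η : ℝ, 0 < η ∧ ∀ u ∈ V O, normV O u ≤ η → ∀ ε : ℝ, 0 < ε → ∀ τ : ℝ, 0 < τ →
      ∃ φ : EuclideanSpace ℝ (Fin d) → ℝ, ∃ hφ : IsTest O φ, ‖u - hφ.toL2‖ < τ ∧
        eLpNorm (fun x => satPow ε m (φ x)) 4 (volume.restrict O) ≤ ENNReal.ofReal C := by
  obtain ⟨S, hS, hsob⟩ := exists_sobolev_const hd hb
  set v : ℝ := (eLpNorm (fun _ : EuclideanSpace ℝ (Fin d) => (1 : ℝ)) 2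
    (volume.restrict O)).toReal with hv
  have hv0 : 0 ≤ v := ENNReal.toReal_nonneg
  set a : ℝ := S * (1 + 2 * m) ^ 2 with ha
  have ha0 : 0 ≤ a := by positivity
  -- Chosen so that `a * η ≤ 1 / 2`, which allows half of `N ^ 2` to be absorbed. It does not depend
  -- on `ε`.
  set η : ℝ := 1 / (2 * (a + 1)) with hη
  have hη0 : 0 < η := by positivity
  have haη : a * η ≤ 1 / 2 := by
    rw [hη, mul_one_div, div_le_div_iff₀ (by positivity) (by norm_num)]
    linarith
  refine ⟨v + 1, η, hη0, fun u hu huη ε hε τ hτ => ?_⟩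
  set M : ℝ := (1 / ε) ^ (2 * m) * (1 + 2 * (2 * m : ℕ)) with hM
  have hM0 : 0 ≤ M := by positivity
  set b : ℝ := d * (M * (η + 1)) with hbdef
  have hb0 : 0 ≤ b := by positivity
  -- The tolerance may depend on `ε` through `b`; it keeps the total error from replacing `∇u` by
  -- `∇φ` below `η`.
  set δ : ℝ := min τ (min 1 (η / (b + 1))) with hδ
  have hδ0 : 0 < δ := by positivity
  have hδ1 : δ ≤ 1 := (min_le_right _ _).trans (min_le_left _ _)
  have hδb : b * δ ≤ η := by
    have : δ ≤ η / (b + 1) := (min_le_right _ _).trans (min_le_right _ _)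
    rw [le_div_iff₀ (by positivity)] at this
    nlinarith
  obtain ⟨φ, hφ, hφ1, hφ2⟩ := hu.1.exists_isTest hO hδ0
  refine ⟨φ, hφ, hφ1.trans_le (min_le_left _ _), ?_⟩
  set N : ℝ := (eLpNorm (fun x => satPow ε m (φ x)) 4 (volume.restrict O)).toReal with hN
  have hP : ∀ i, ‖hφ.partialL2 i‖ ≤ η + 1 := fun i => by
    have h1 := norm_sub_norm_le (hφ.partialL2 i) (weakPartial O i u)
    rw [norm_sub_rev] at h1
    have h2 := norm_weakPartial_le_normV u i
    linarith [hφ2 i]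
  have hΨ := hφ.norm_toL2_satPow_le hb hε m
  set hψ := hφ.satPow hε (2 * m) with hψdef
  have hW : ∀ i, ‖hψ.partialL2 i‖ ≤ M * (η + 1) := fun i =>
    (hφ.norm_partialL2_satPow_le hε (2 * m) i).trans (mul_le_mul_of_nonneg_left (hP i) hM0)
  have hmain : ∑ i, ⟪hφ.partialL2 i, hψ.partialL2 i⟫_ℝ ≤ η * (v + N ^ 2) + η := by
    -- The weak equation holds for `u`, not for `φ`; the second sum is the resulting error.
    have e : ∑ i, ⟪hφ.partialL2 i, hψ.partialL2 i⟫_ℝ =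
        -⟪weakLaplacian O u, hψ.toL2⟫_ℝ -
          ∑ i, ⟪weakPartial O i u - hφ.partialL2 i, hψ.partialL2 i⟫_ℝ := by
      rw [← hu.2.sum_inner_weakPartial hO hψ, ← Finset.sum_sub_distrib]
      refine Finset.sum_congr rfl fun i _ => ?_
      rw [inner_sub_left]
      ring
    have h1 : -⟪weakLaplacian O u, hψ.toL2⟫_ℝ ≤ η * (v + N ^ 2) := by
      refine (neg_le_abs _).trans ((abs_real_inner_le_norm _ _).trans ?_)
      exact mul_le_mul ((normH20_le_normV u).trans huη) hΨ (norm_nonneg _) hη0.le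
    have h2 : -∑ i, ⟪weakPartial O i u - hφ.partialL2 i, hψ.partialL2 i⟫_ℝ ≤ η := by
      rw [← Finset.sum_neg_distrib]
      refine (Finset.sum_le_sum (g := fun _ => δ * (M * (η + 1))) fun i _ => ?_).trans ?_
      · refine (neg_le_abs _).trans ((abs_real_inner_le_norm _ _).trans ?_)
        exact mul_le_mul (hφ2 i).le (hW i) (norm_nonneg _) hδ0.le
      · rw [Finset.sum_const, Finset.card_univ, Fintype.card_fin, nsmul_eq_mul]
        refine le_trans (le_of_eq ?_) hδb
        rw [hbdef]
        ring
    rw [e]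
    linarith
  have hN2 : N ^ 2 ≤ a * ∑ i, ⟪hφ.partialL2 i, hψ.partialL2 i⟫_ℝ := by
    refine (hsob _ (hφ.satPow hε m)).trans ?_
    rw [ha, mul_assoc]
    refine mul_le_mul_of_nonneg_left ?_ hS
    rw [Finset.mul_sum]
    exact Finset.sum_le_sum fun i _ => hφ.norm_partialL2_satPow_sq_le hε m i
  have hN3 : N ^ 2 ≤ v + 1 := by
    have h1 := hN2.trans (mul_le_mul_of_nonneg_left hmain ha0)
    -- Absorption: `N` is finite because `φ` is a test function, so `N ^ 2 / 2` may be moved to the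
    -- left.
    have h2 : a * (η * (v + N ^ 2) + η) ≤ 1 / 2 * (v + N ^ 2 + 1) := by
      have : 0 ≤ v + N ^ 2 + 1 := by positivity
      nlinarith [mul_le_mul_of_nonneg_right haη this]
    linarith
  have hN4 : N ≤ v + 1 := by nlinarith [sq_nonneg (N - 1)]
  exact (ENNReal.le_ofReal_iff_toReal_le (hφ.satPow hε m).memLp_four.2.ne (by positivity)).2 hN4

/-- The truncated bound is uniform in `ε`. With `ε = 1 / (j + 1)` and test functions `φ j → u` in
`L²`, a subsequence converges almost everywhere and Fatou's lemma carries the bound to the limit. -/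
theorem exists_eLpNorm_pow_le (hd : d = 2 ∨ d = 3) (hO : IsOpen O)
    (hb : Bornology.IsBounded O) (m : ℕ) :
    ∃ C η : ℝ, 0 < η ∧ ∀ u ∈ V O, normV O u ≤ η →
      eLpNorm (fun x => u x ^ (2 * m + 1)) 4 (volume.restrict O) ≤ ENNReal.ofReal C := by
  obtain ⟨C, η, hη, h⟩ := exists_isTest_satPow_bound hd hO hb m
  refine ⟨C, η, hη, fun u hu huη => ?_⟩
  have hpos : ∀ j : ℕ, (0 : ℝ) < 1 / ((j : ℝ) + 1) := fun j => Nat.one_div_pos_of_nat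
  choose φ hφ h1 h2 using fun j : ℕ => h u hu huη _ (hpos j) _ (hpos j)
  have hlim : Tendsto (fun j : ℕ => 1 / ((j : ℝ) + 1)) atTop (𝓝 0) :=
    tendsto_one_div_add_atTop_nhds_zero_nat
  have hconv : Tendsto (fun j => eLpNorm (φ j - (u : EuclideanSpace ℝ (Fin d) → ℝ)) 2
      (volume.restrict O)) atTop (𝓝 0) := by
    have e : ∀ j, eLpNorm (φ j - (u : EuclideanSpace ℝ (Fin d) → ℝ)) 2 (volume.restrict O) =
        ENNReal.ofReal ‖u - (hφ j).toL2‖ := fun j => by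
      rw [Lp.norm_def, ENNReal.ofReal_toReal (Lp.eLpNorm_ne_top _), eLpNorm_sub_comm]
      refine eLpNorm_congr_ae ?_
      filter_upwards [Lp.coeFn_sub u (hφ j).toL2, (hφ j).memLp.coeFn_toLp] with x hx hx'
      rw [hx, Pi.sub_apply, Pi.sub_apply, IsTest.toL2, hx']
    simp_rw [e]
    rw [← ENNReal.ofReal_zero]
    exact ENNReal.tendsto_ofReal
      (squeeze_zero (fun _ => norm_nonneg _) (fun j => (h1 j).le) hlim)
  obtain ⟨ns, hns, hae⟩ := (tendstoInMeasure_of_tendsto_eLpNorm (by norm_num)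
    (fun j => (hφ j).memLp.1) (Lp.memLp u).1 hconv).exists_seq_tendsto_ae
  refine (Lp.eLpNorm_lim_le_liminf_eLpNorm
    (f := fun j x => satPow (1 / ((ns j : ℝ) + 1)) m (φ (ns j) x))
    (fun j => ((hφ (ns j)).satPow (hpos _) m).memLp.1) _ ?_).trans ?_
  · filter_upwards [hae] with x hx
    exact tendsto_satPow m (hlim.comp hns.tendsto_atTop) hx
  · refine (liminf_le_liminf (v := fun _ => ENNReal.ofReal C)
      (Eventually.of_forall fun j => h2 (ns j))).trans (le_of_eq ?_)
    exact liminf_const _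

/-- The embedding of `V` into `L^p(O)` for every finite exponent `p`. -/
theorem exists_eLpNorm_le_normV (hd : d = 2 ∨ d = 3) (hO : IsOpen O)
    (hb : Bornology.IsBounded O) {p : ℝ} (hp : 0 < p) :
    ∃ C : ℝ, 0 ≤ C ∧ ∀ u ∈ V O,
      eLpNorm u (ENNReal.ofReal p) (volume.restrict O) ≤ ENNReal.ofReal (C * normV O u) := by
  -- A bound on `u ^ (2m+1)` in `L⁴` is one on `u` in `L^{4(2m+1)}`, an exponent above `p`; finite
  -- measure of `O` does the rest.
  obtain ⟨m, hm⟩ := exists_nat_ge p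
  obtain ⟨C, η, hη, h⟩ := exists_eLpNorm_pow_le hd hO hb m
  set r : ℝ := 2 * m + 1 with hr
  have hr0 : 0 < r := by positivity
  have hpr : ENNReal.ofReal p ≤ 4 * ENNReal.ofReal r := by
    rw [← ENNReal.ofReal_ofNat 4, ← ENNReal.ofReal_mul (by norm_num)]
    refine ENNReal.ofReal_le_ofReal ?_
    have : (0 : ℝ) ≤ m := by positivity
    rw [hr]
    linarith
  set B : ℝ≥0∞ := ENNReal.ofReal C ^ r⁻¹ * (volume.restrict O) univ ^
    (1 / (ENNReal.ofReal p).toReal - 1 / (4 * ENNReal.ofReal r).toReal) with hB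
  have hsmall : ∀ u ∈ V O, normV O u ≤ η →
      eLpNorm u (ENNReal.ofReal p) (volume.restrict O) ≤ B := by
    intro u hu huη
    refine (eLpNorm_le_eLpNorm_mul_rpow_measure_univ hpr (Lp.memLp u).1).trans ?_
    rw [hB]
    gcongr
    rw [ENNReal.le_rpow_inv_iff hr0, ← eLpNorm_norm_rpow _ hr0]
    refine le_trans (le_of_eq (eLpNorm_congr_norm_ae (ae_of_all _ fun x => ?_))) (h u hu huη)
    rw [norm_pow, Real.norm_of_nonneg (by positivity), hr, ← Real.rpow_natCast]
    push_cast
    rfl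
  have hvol : volume.restrict O univ ≠ ⊤ := by
    rw [Measure.restrict_apply_univ]
    exact hb.measure_lt_top.ne
  have hqtop : 4 * ENNReal.ofReal r ≠ ⊤ := ENNReal.mul_ne_top (by norm_num) ENNReal.ofReal_ne_top
  have hBtop : B ≠ ⊤ := by
    refine ENNReal.mul_ne_top (ENNReal.rpow_ne_top_of_nonneg (by positivity) ENNReal.ofReal_ne_top)
      (ENNReal.rpow_ne_top_of_nonneg (sub_nonneg.2 (one_div_le_one_div_of_le ?_
        (ENNReal.toReal_mono hqtop hpr))) hvol)
    rwa [ENNReal.toReal_ofReal hp.le]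
  refine ⟨B.toReal / η, by positivity, fun u hu => ?_⟩
  rcases (normV_nonneg u).eq_or_lt with h0 | h0
  · have hu0 : u = 0 := norm_le_zero_iff.1 ((norm_le_normV u).trans h0.ge)
    rw [hu0, eLpNorm_congr_ae (Lp.coeFn_zero ℝ 2 (volume.restrict O)), eLpNorm_zero]
    exact zero_le
  -- Scale `u` to size `η`, apply the small case, and scale back by homogeneity.
  · set c : ℝ := η / normV O u with hc
    have hc0 : 0 < c := by positivity
    have hcu : normV O (c • u) ≤ η := by
      rw [hu.2.normV_smul hO, abs_of_pos hc0, hc, div_mul_cancel₀ _ h0.ne']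
    have h1 := hsmall _ ((V O).smul_mem c hu) hcu
    rw [eLpNorm_congr_ae (Lp.coeFn_smul c u), eLpNorm_const_smul,
      Real.enorm_of_nonneg hc0.le, mul_comm] at h1
    have h2 : B.toReal / η * normV O u = B.toReal / c := by
      rw [hc]
      field_simp
    rw [h2, ENNReal.ofReal_div_of_pos hc0, ENNReal.ofReal_toReal hBtop]
    exact (ENNReal.le_div_iff_mul_le (Or.inl (by simpa using hc0))
      (Or.inl ENNReal.ofReal_ne_top)).2 h1

/-! ### The odd power as a map from `V` to `L²` -/

theorem abs_rpow_sub_rpow_le {p : ℝ} (hp : 1 ≤ p) {x y : ℝ} (hx : 0 ≤ x) (hy : 0 ≤ y) :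
    |x ^ p - y ^ p| ≤ p * (x ^ (p - 1) + y ^ (p - 1)) * |x - y| := by
  have hM : ∀ z ∈ Icc 0 (max x y), ‖p * z ^ (p - 1)‖ ≤ p * (x ^ (p - 1) + y ^ (p - 1)) := by
    intro z hz
    have hz0 := hz.1
    rw [Real.norm_of_nonneg (by positivity)]
    refine mul_le_mul_of_nonneg_left ?_ (by linarith)
    have h1 : z ^ (p - 1) ≤ (max x y) ^ (p - 1) :=
      Real.rpow_le_rpow hz0 hz.2 (by linarith)
    have hx' : 0 ≤ x ^ (p - 1) := by positivity
    have hy' : 0 ≤ y ^ (p - 1) := by positivity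
    rcases max_choice x y with h | h <;> rw [h] at h1 <;> linarith
  exact (convex_Icc (0 : ℝ) (max x y)).norm_image_sub_le_of_norm_hasDerivWithin_le
    (f := fun z => z ^ p) (fun z _ => (Real.hasDerivAt_rpow_const (Or.inr hp)).hasDerivWithinAt)
    hM ⟨hy, le_max_right x y⟩ ⟨hx, le_max_left x y⟩

theorem abs_oddPow_sub_le {n : ℝ} (hn : 1 ≤ n) (a b : ℝ) :
    |oddPow n a - oddPow n b| ≤ 2 * n * (|a| ^ (2 * n - 2) + |b| ^ (2 * n - 2)) * |a - b| := by
  wlog hab : |b| ≤ |a| generalizing a b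
  · have h := this b a (le_of_not_ge hab)
    rwa [abs_sub_comm, abs_sub_comm a b, add_comm (|a| ^ _)]
  have hr : 0 ≤ 2 * n - 2 := by linarith
  have hsucc : ∀ s : ℝ, |s| ^ (2 * n - 1) = |s| ^ (2 * n - 2) * |s| := fun s => by
    rw [← Real.rpow_add_one' (abs_nonneg s) (by linarith)]
    ring_nf
  have hA : 0 ≤ |a| ^ (2 * n - 2) := by positivity
  have hB : 0 ≤ |b| ^ (2 * n - 2) := by positivity
  have hBA : |b| ^ (2 * n - 2) ≤ |a| ^ (2 * n - 2) := Real.rpow_le_rpow (abs_nonneg b) hab hr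
  have h1 := abs_rpow_sub_rpow_le (p := 2 * n - 1) (by linarith) (abs_nonneg a) (abs_nonneg b)
  rw [hsucc, hsucc, show 2 * n - 1 - 1 = 2 * n - 2 by ring] at h1
  have h2 : |(|a| - |b|)| ≤ |a - b| := abs_abs_sub_abs_le a b
  -- Since `|b| ≤ |a|`, replacing `|a|` by `|b|` in the last factor only lowers the right side. This
  -- avoids differentiating `|s| ^ (2 * n - 2)`, whose exponent may be below `1`.
  have h3 : |(|a| ^ (2 * n - 2) - |b| ^ (2 * n - 2)) * b| ≤
      |(|a| ^ (2 * n - 2) * |a| - |b| ^ (2 * n - 2) * |b|)| := by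
    rw [abs_mul, abs_of_nonneg (sub_nonneg.2 hBA)]
    refine le_trans ?_ (le_abs_self _)
    nlinarith
  have h4 : oddPow n a - oddPow n b =
      |a| ^ (2 * n - 2) * (a - b) + (|a| ^ (2 * n - 2) - |b| ^ (2 * n - 2)) * b := by
    rw [oddPow, oddPow]
    ring
  have h5 : (2 * n - 1) * (|a| ^ (2 * n - 2) + |b| ^ (2 * n - 2)) * |(|a| - |b|)| ≤
      (2 * n - 1) * (|a| ^ (2 * n - 2) + |b| ^ (2 * n - 2)) * |a - b| :=
    mul_le_mul_of_nonneg_left h2 (mul_nonneg (by linarith) (by linarith))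
  have h6 : |(|a| ^ (2 * n - 2) * (a - b))| = |a| ^ (2 * n - 2) * |a - b| := by
    rw [abs_mul, abs_of_nonneg hA]
  rw [h4]
  refine (abs_add_le _ _).trans ?_
  rw [h6]
  nlinarith [mul_nonneg hB (abs_nonneg (a - b))]

theorem rpow_le_one_add_rpow {x r s : ℝ} (hx : 0 ≤ x) (hr : 0 ≤ r) (hrs : r ≤ s) :
    x ^ r ≤ 1 + x ^ s := by
  rcases le_total x 1 with h | h
  · linarith [Real.rpow_le_one hx h hr, Real.rpow_nonneg hx s]
  · linarith [Real.rpow_le_rpow_of_exponent_le h hrs]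

theorem abs_oddPow {n : ℝ} (hn : 1 ≤ n) (s : ℝ) : |oddPow n s| = |s| ^ (2 * n - 1) := by
  rw [oddPow, abs_mul, abs_of_nonneg (Real.rpow_nonneg (abs_nonneg s) _),
    ← Real.rpow_add_one' (abs_nonneg s) (by linarith)]
  ring_nf

theorem measurable_oddPow (n : ℝ) : Measurable (oddPow n) := by
  unfold oddPow
  fun_prop

theorem memLp_of_mem_V (hd : d = 2 ∨ d = 3) (hO : IsOpen O) (hb : Bornology.IsBounded O)
    {p : ℝ} (hp : 0 < p) {u : L2 O} (hu : u ∈ V O) :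
    MemLp u (ENNReal.ofReal p) (volume.restrict O) := by
  obtain ⟨C, -, hC⟩ := exists_eLpNorm_le_normV hd hO hb hp
  exact ⟨(Lp.memLp u).1, (hC u hu).trans_lt ENNReal.ofReal_lt_top⟩

theorem memLp_oddPow (hd : d = 2 ∨ d = 3) (hO : IsOpen O) (hb : Bornology.IsBounded O)
    {n : ℝ} (hn : 1 ≤ n) {u : L2 O} (hu : u ∈ V O) :
    MemLp (fun x => oddPow n (u x)) 2 (volume.restrict O) := by
  have h := memLp_of_mem_V hd hO hb (p := 2 * (2 * n - 1)) (by linarith) hu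
  refine ⟨((measurable_oddPow n).comp_aemeasurable
    (Lp.memLp u).1.aemeasurable).aestronglyMeasurable, ?_⟩
  have e : eLpNorm (fun x => oddPow n (u x)) 2 (volume.restrict O) =
      eLpNorm (fun x => ‖u x‖ ^ (2 * n - 1)) 2 (volume.restrict O) := by
    refine eLpNorm_congr_norm_ae (ae_of_all _ fun x => ?_)
    rw [Real.norm_eq_abs, abs_oddPow hn, Real.norm_of_nonneg (by positivity), Real.norm_eq_abs]
  rw [e, eLpNorm_norm_rpow _ (by linarith)]
  rw [ENNReal.ofReal_mul zero_le_two, ENNReal.ofReal_ofNat] at h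
  exact ENNReal.rpow_lt_top_of_nonneg (by linarith) h.2.ne

theorem eLpNorm_norm_rpow_le (hd : d = 2 ∨ d = 3) (hO : IsOpen O) (hb : Bornology.IsBounded O)
    {s : ℝ} (hs : 0 < s) :
    ∃ C : ℝ, 0 ≤ C ∧ ∀ u ∈ V O, eLpNorm (fun x => ‖u x‖ ^ s) 4 (volume.restrict O) ≤
      ENNReal.ofReal (C * normV O u ^ s) := by
  obtain ⟨C, hC0, hC⟩ := exists_eLpNorm_le_normV hd hO hb (p := 4 * s) (by linarith)
  refine ⟨C ^ s, by positivity, fun u hu => ?_⟩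
  have hN := normV_nonneg u
  rw [eLpNorm_norm_rpow _ hs, ← ENNReal.ofReal_ofNat 4, ← ENNReal.ofReal_mul (by norm_num),
    ← Real.mul_rpow hC0 hN, ← ENNReal.ofReal_rpow_of_nonneg (by positivity) hs.le]
  exact ENNReal.rpow_le_rpow (hC u hu) hs.le

/-- The odd power is locally Lipschitz from `V` to `L²(O)`. -/
theorem exists_norm_oddPow_sub_le (hd : d = 2 ∨ d = 3) (hO : IsOpen O)
    (hb : Bornology.IsBounded O) {n : ℝ} (hn : 1 ≤ n) :
    ∃ K : ℝ, 0 ≤ K ∧ ∀ (u v : L2 O) (hu : u ∈ V O) (hv : v ∈ V O),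
      ‖(memLp_oddPow hd hO hb hn hu).toLp _ - (memLp_oddPow hd hO hb hn hv).toLp _‖ ≤
        K * (1 + (normV O u ^ (2 * n) + normV O v ^ (2 * n))) * normV O (u - v) := by
  obtain ⟨C, hC0, hC⟩ := exists_eLpNorm_le_normV hd hO hb (p := 4) (by norm_num)
  obtain ⟨D, hD0, hD⟩ := eLpNorm_norm_rpow_le hd hO hb (s := 2 * n) (by linarith)
  rw [ENNReal.ofReal_ofNat] at hC
  have hone := (memLp_one_of_isBounded hb 4).2.ne
  set e1 : ℝ := (eLpNorm (fun _ : EuclideanSpace ℝ (Fin d) => (1 : ℝ)) 4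
    (volume.restrict O)).toReal with he1
  have he0 : 0 ≤ e1 := ENNReal.toReal_nonneg
  have hn0 : 0 ≤ n := by linarith
  refine ⟨2 * n * (2 * e1 + D) * C, by positivity, fun u v hu hv => ?_⟩
  have hNu := normV_nonneg u
  have hNv := normV_nonneg v
  have hNw := normV_nonneg (u - v)
  have hmeas : ∀ w : L2 O, AEStronglyMeasurable (fun x => ‖w x‖ ^ (2 * n)) (volume.restrict O) :=
    fun w => ((Lp.memLp w).1.aemeasurable.norm.pow_const _).aestronglyMeasurable
  set W : EuclideanSpace ℝ (Fin d) → ℝ :=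
    (2 * n) • ((2 : ℝ) • (fun _ => (1 : ℝ)) + (fun x => ‖u x‖ ^ (2 * n)) +
      fun x => ‖v x‖ ^ (2 * n)) with hW
  have hWm : AEStronglyMeasurable W (volume.restrict O) :=
    (((aestronglyMeasurable_const.const_smul _).add (hmeas u)).add (hmeas v)).const_smul _
  have hW4 : eLpNorm W 4 (volume.restrict O) ≤
      ENNReal.ofReal (2 * n * (2 * e1 + D * normV O u ^ (2 * n) + D * normV O v ^ (2 * n))) := by
    rw [hW, eLpNorm_const_smul, Real.enorm_of_nonneg (by positivity),
      ENNReal.ofReal_mul (p := 2 * n) (by positivity)]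
    refine mul_le_mul' le_rfl ?_
    rw [ENNReal.ofReal_add (by positivity) (by positivity),
      ENNReal.ofReal_add (by positivity) (by positivity)]
    refine (eLpNorm_add_le ((aestronglyMeasurable_const.const_smul _).add (hmeas u)) (hmeas v)
      (by norm_num)).trans (add_le_add ?_ (hD v hv))
    refine (eLpNorm_add_le (aestronglyMeasurable_const.const_smul _) (hmeas u)
      (by norm_num)).trans (add_le_add ?_ (hD u hu))
    rw [eLpNorm_const_smul, Real.enorm_of_nonneg (by norm_num),
      ENNReal.ofReal_mul (by norm_num), he1, ENNReal.ofReal_toReal hone]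
  have : ENNReal.HolderTriple 4 4 2 := ⟨by
    rw [← ENNReal.toReal_eq_toReal_iff' (by simp) (by simp), ENNReal.toReal_add (by simp) (by simp)]
    norm_num⟩
  have hle : eLpNorm (fun x => oddPow n (u x) - oddPow n (v x)) 2 (volume.restrict O) ≤
      ENNReal.ofReal (2 * n * (2 * e1 + D * normV O u ^ (2 * n) + D * normV O v ^ (2 * n))) *
        ENNReal.ofReal (C * normV O (u - v)) := by
    refine le_trans ?_ ((eLpNorm_smul_le_mul_eLpNorm (p := 4) (q := 4) (r := 2)
      (Lp.memLp (u - v)).1 hWm).trans (mul_le_mul' hW4 (hC _ ((V O).sub_mem hu hv))))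
    refine eLpNorm_mono_ae ?_
    filter_upwards [Lp.coeFn_sub u v] with x hx
    -- The exponent `2 * n - 2` vanishes at `n = 1`; raising it to `2 * n` gives a positive exponent
    -- and matches a term of the final bound, at the cost of the constant `1`.
    have h1 := rpow_le_one_add_rpow (abs_nonneg (u x)) (r := 2 * n - 2) (s := 2 * n)
      (by linarith) (by linarith)
    have h2 := rpow_le_one_add_rpow (abs_nonneg (v x)) (r := 2 * n - 2) (s := 2 * n)
      (by linarith) (by linarith)
    rw [Pi.smul_apply', norm_smul, hx, Pi.sub_apply, Real.norm_eq_abs, Real.norm_eq_abs (u x - v x)]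
    refine (abs_oddPow_sub_le hn _ _).trans (mul_le_mul_of_nonneg_right ?_ (abs_nonneg _))
    refine le_trans ?_ (le_abs_self _)
    simp only [hW, Pi.smul_apply, Pi.add_apply, smul_eq_mul, Real.norm_eq_abs]
    refine mul_le_mul_of_nonneg_left ?_ (by linarith)
    linarith
  rw [← MemLp.toLp_sub, Lp.norm_toLp]
  rw [← ENNReal.ofReal_mul (by positivity)] at hle
  refine (ENNReal.toReal_le_of_le_ofReal (by positivity) hle).trans ?_
  have hp : 0 ≤ 2 * n * (C * normV O (u - v)) := by positivity
  have hu' : 0 ≤ normV O u ^ (2 * n) := by positivity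
  have hv' : 0 ≤ normV O v ^ (2 * n) := by positivity
  have hq : 2 * e1 + D * normV O u ^ (2 * n) + D * normV O v ^ (2 * n) ≤
      (2 * e1 + D) * (1 + (normV O u ^ (2 * n) + normV O v ^ (2 * n))) := by
    nlinarith [mul_nonneg he0 hu', mul_nonneg he0 hv']
  calc _ = 2 * n * (C * normV O (u - v)) *
        (2 * e1 + D * normV O u ^ (2 * n) + D * normV O v ^ (2 * n)) := by ring
    _ ≤ _ := mul_le_mul_of_nonneg_left hq hp
    _ = _ := by ring

/-! ### The terms with scalar coefficients -/

theorem normLp_nonneg (p : ℝ) (u : L2 O) : 0 ≤ normLp O p u := ENNReal.toReal_nonneg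

theorem abs_normLp_sub_le {p : ℝ} (hp : 1 ≤ p) {u v : L2 O}
    (hu : MemLp u (ENNReal.ofReal p) (volume.restrict O))
    (hv : MemLp v (ENNReal.ofReal p) (volume.restrict O)) :
    |normLp O p u - normLp O p v| ≤ normLp O p (u - v) := by
  have : Fact (1 ≤ ENNReal.ofReal p) := ⟨ENNReal.one_le_ofReal.2 hp⟩
  have h := abs_norm_sub_norm_le (hu.toLp u) (hv.toLp v)
  rwa [← MemLp.toLp_sub, Lp.norm_toLp, Lp.norm_toLp, Lp.norm_toLp,
    ← eLpNorm_congr_ae (Lp.coeFn_sub u v)] at h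

theorem norm_smul_sub_smul_le {E : Type*} [NormedAddCommGroup E] [NormedSpace ℝ E] (a b : ℝ)
    (x y : E) : ‖a • x - b • y‖ ≤ |a| * ‖x - y‖ + |a - b| * ‖y‖ := by
  have e : a • x - b • y = a • (x - y) + (a - b) • y := by
    rw [smul_sub, sub_smul]
    abel
  rw [e]
  refine (norm_add_le _ _).trans ?_
  rw [norm_smul, norm_smul, Real.norm_eq_abs, Real.norm_eq_abs]

/-- Difference estimate for `a ^ 2 • x`, where `a` is a seminorm dominated by the norm `N`. -/
theorem norm_sq_smul_sub_sq_smul_le {E : Type*} [NormedAddCommGroup E] [NormedSpace ℝ E]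
    {a b M N δ : ℝ} {x y : E} (ha : 0 ≤ a) (hb : 0 ≤ b) (haM : a ≤ M) (hbN : b ≤ N)
    (hab : |a - b| ≤ δ) (hxy : ‖x - y‖ ≤ δ) (hy : ‖y‖ ≤ N) :
    ‖a ^ 2 • x - b ^ 2 • y‖ ≤ (M ^ 2 + N ^ 2 + M * N) * δ := by
  have hδ : 0 ≤ δ := (abs_nonneg _).trans hab
  have h1 : |a ^ 2 - b ^ 2| ≤ (M + N) * δ := by
    rw [sq_sub_sq, abs_mul, abs_of_nonneg (add_nonneg ha hb)]
    exact mul_le_mul (add_le_add haM hbN) hab (abs_nonneg _) (by linarith)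
  have h2 : |a ^ 2| ≤ M ^ 2 := by
    rw [abs_of_nonneg (sq_nonneg a)]
    exact pow_le_pow_left₀ ha haM 2
  have h3 : |a ^ 2| * ‖x - y‖ ≤ M ^ 2 * δ := mul_le_mul h2 hxy (norm_nonneg _) (sq_nonneg M)
  have h4 : |a ^ 2 - b ^ 2| * ‖y‖ ≤ (M + N) * δ * N :=
    mul_le_mul h1 hy (norm_nonneg _) (mul_nonneg (by linarith) hδ)
  refine (norm_smul_sub_smul_le _ _ x y).trans ?_
  linarith

/-- By `norm_smul_sub_smul_le`, varying the vector costs the terms of degree `p`, and varying the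
coefficient costs the product terms, by the mean value estimate for `x ^ p` and the triangle
inequality in `L^p`. -/
theorem exists_norm_normLp_rpow_smul_sub_le (hd : d = 2 ∨ d = 3) (hO : IsOpen O)
    (hb : Bornology.IsBounded O) {p : ℝ} (hp : 1 ≤ p) :
    ∃ K : ℝ, 0 ≤ K ∧ ∀ u ∈ V O, ∀ v ∈ V O,
      ‖normLp O p u ^ p • u - normLp O p v ^ p • v‖ ≤
        K * ((normV O u ^ (p - 1) + normV O v ^ (p - 1)) * (normV O u + normV O v) +
          (normV O u ^ p + normV O v ^ p)) * normV O (u - v) := by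
  have hp0 : 0 < p := by linarith
  obtain ⟨C, hC0, hC⟩ := exists_eLpNorm_le_normV hd hO hb hp0
  have hle : ∀ u ∈ V O, normLp O p u ≤ C * normV O u := fun u hu =>
    ENNReal.toReal_le_of_le_ofReal (mul_nonneg hC0 (normV_nonneg u)) (hC u hu)
  set A : ℝ := C ^ p with hA
  set B : ℝ := p * C ^ (p - 1) * C with hB
  have hA0 : 0 ≤ A := by positivity
  have hB0 : 0 ≤ B := by positivity
  refine ⟨A + B, by positivity, fun u hu v hv => ?_⟩
  have hu0 := normV_nonneg u
  have hv0 := normV_nonneg v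
  have hw0 := normV_nonneg (u - v)
  have hpow : ∀ w ∈ V O, ∀ q : ℝ, 0 ≤ q → normLp O p w ^ q ≤ C ^ q * normV O w ^ q := by
    intro w hw q hq
    rw [← Real.mul_rpow hC0 (normV_nonneg w)]
    exact Real.rpow_le_rpow (normLp_nonneg p w) (hle w hw) hq
  have h1 : |normLp O p u ^ p| ≤ A * normV O u ^ p := by
    rw [abs_of_nonneg (Real.rpow_nonneg (normLp_nonneg p u) _)]
    exact hpow u hu p hp0.le
  have h2 : |normLp O p u ^ p - normLp O p v ^ p| ≤
      B * (normV O u ^ (p - 1) + normV O v ^ (p - 1)) * normV O (u - v) := by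
    have h3 := (abs_normLp_sub_le hp (memLp_of_mem_V hd hO hb hp0 hu)
      (memLp_of_mem_V hd hO hb hp0 hv)).trans (hle _ ((V O).sub_mem hu hv))
    have h4 := hpow u hu (p - 1) (by linarith)
    have h5 := hpow v hv (p - 1) (by linarith)
    refine (abs_rpow_sub_rpow_le hp (normLp_nonneg p u) (normLp_nonneg p v)).trans ?_
    calc _ ≤ p * (C ^ (p - 1) * normV O u ^ (p - 1) + C ^ (p - 1) * normV O v ^ (p - 1)) *
          (C * normV O (u - v)) := by gcongr
      _ = _ := by rw [hB]; ring
  have h3 : |normLp O p u ^ p| * ‖u - v‖ ≤ A * normV O u ^ p * normV O (u - v) :=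
    mul_le_mul h1 (norm_le_normV _) (norm_nonneg _) (by positivity)
  have h4 : |normLp O p u ^ p - normLp O p v ^ p| * ‖v‖ ≤
      B * (normV O u ^ (p - 1) + normV O v ^ (p - 1)) * normV O (u - v) *
        (normV O u + normV O v) :=
    mul_le_mul h2 ((norm_le_normV v).trans (by linarith)) (norm_nonneg _) (by positivity)
  refine (norm_smul_sub_smul_le _ _ u v).trans ((add_le_add h3 h4).trans ?_)
  have i1 : 0 ≤ A * normV O v ^ p * normV O (u - v) := by positivity
  have i2 : 0 ≤ B * (normV O u ^ p + normV O v ^ p) * normV O (u - v) := by positivity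
  have i3 : 0 ≤ A * (normV O u ^ (p - 1) + normV O v ^ (p - 1)) * normV O (u - v) *
    (normV O u + normV O v) := by positivity
  linarith

end ConstrainedSH

end

/-! ### Assembly of the estimate -/

theorem mainTheorem2 (d : ℕ) (hd : d = 2 ∨ d = 3) (O : Set (EuclideanSpace ℝ (Fin d)))
    (hO : ConstrainedSH.IsBoundedSmoothDomain O) (n : ℝ) (hn : 1 ≤ n) :
    (∀ u : ConstrainedSH.V O,
      MemLp (u : ConstrainedSH.L2 O) (ENNReal.ofReal (2 * n)) (volume.restrict O)) ∧
    ∃ F : ConstrainedSH.V O → ConstrainedSH.L2 O,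
      (∀ u : ConstrainedSH.V O,
        F u =ᵐ[volume.restrict O] ConstrainedSH.nonlinearity O n (u : ConstrainedSH.L2 O)) ∧
      (∃ K : ℝ, ∀ u₁ u₂ : ConstrainedSH.V O,
        ‖F u₁ - F u₂‖ ≤
          K * ((ConstrainedSH.normV O u₁ ^ 2 + ConstrainedSH.normV O u₂ ^ 2
                  + ConstrainedSH.normV O u₁ * ConstrainedSH.normV O u₂)
              + (ConstrainedSH.normV O u₁ ^ (2 * n - 1) + ConstrainedSH.normV O u₂ ^ (2 * n - 1))
                  * (ConstrainedSH.normV O u₁ + ConstrainedSH.normV O u₂)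
              + (ConstrainedSH.normV O u₁ ^ (2 * n) + ConstrainedSH.normV O u₂ ^ (2 * n))
              + (1 + ConstrainedSH.normV O u₁ ^ 2 + ConstrainedSH.normV O u₂ ^ 2) ^ (1 / 3 : ℝ))
            * ConstrainedSH.normV O (u₁ - u₂)) ∧
      (∀ R : ℝ, ∃ L : ℝ, ∀ u₁ u₂ : ConstrainedSH.V O,
        ConstrainedSH.normV O u₁ ≤ R → ConstrainedSH.normV O u₂ ≤ R →
          ‖F u₁ - F u₂‖ ≤ L * ConstrainedSH.normV O (u₁ - u₂)) := by
  open ConstrainedSH in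
  have ho := hO.isOpen
  have hb := hO.isBounded
  refine ⟨fun u => memLp_of_mem_V hd ho hb (by linarith) u.2, ?_⟩
  obtain ⟨K₁, hK₁, h₁⟩ := exists_norm_normLp_rpow_smul_sub_le hd ho hb (p := 2 * n) (by linarith)
  obtain ⟨K₂, hK₂, h₂⟩ := exists_norm_oddPow_sub_le hd ho hb hn
  set F : V O → L2 O := fun u =>
    normH20 O u ^ 2 • (u : L2 O) + (2 : ℝ) • (normH10 O u ^ 2 • (u : L2 O)) +
      normLp O (2 * n) u ^ (2 * n) • (u : L2 O) - (memLp_oddPow hd ho hb hn u.2).toLp _ with hF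
  set bracket : ℝ → ℝ → ℝ := fun a b => (a ^ 2 + b ^ 2 + a * b)
    + (a ^ (2 * n - 1) + b ^ (2 * n - 1)) * (a + b) + (a ^ (2 * n) + b ^ (2 * n))
    + (1 + a ^ 2 + b ^ 2) ^ (1 / 3 : ℝ) with hbr
  -- The `3` counts the Laplacian term once and the gradient term twice.
  have hmain : ∀ u₁ u₂ : V O, ‖F u₁ - F u₂‖ ≤
      (3 + K₁ + K₂) * bracket (normV O u₁) (normV O u₂) * normV O (u₁ - u₂) := by
    rintro ⟨u, hu⟩ ⟨v, hv⟩
    simp only [hF, hbr]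
    have hδ0 := normV_nonneg (u - v)
    have hu0 := normV_nonneg u
    have hv0 := normV_nonneg v
    have t1 := norm_sq_smul_sub_sq_smul_le (normH20_nonneg u) (normH20_nonneg v)
      (normH20_le_normV u) (normH20_le_normV v)
      ((hu.2.abs_normH20_sub_le ho hv.2).trans (normH20_le_normV _)) (norm_le_normV (u - v))
      (norm_le_normV v)
    have t2 := norm_sq_smul_sub_sq_smul_le (normH10_nonneg u) (normH10_nonneg v)
      (normH10_le_normV u) (normH10_le_normV v)
      ((hu.2.abs_normH10_sub_le ho hv.2).trans (normH10_le_normV _)) (norm_le_normV (u - v))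
      (norm_le_normV v)
    have t3 := h₁ u hu v hv
    have t4 := h₂ u v hu hv
    have e : ∀ a b c z a' b' c' z' : L2 O,
        ‖(a + (2 : ℝ) • b + c - z) - (a' + (2 : ℝ) • b' + c' - z')‖ ≤
        ‖a - a'‖ + 2 * ‖b - b'‖ + ‖c - c'‖ + ‖z - z'‖ := by
      intro a b c z a' b' c' z'
      have e' : (a + (2 : ℝ) • b + c - z) - (a' + (2 : ℝ) • b' + c' - z') =
          (a - a') + (2 : ℝ) • (b - b') + (c - c') - (z - z') := by
        rw [smul_sub]
        abel
      rw [e']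
      refine (norm_sub_le _ _).trans ?_
      gcongr
      refine (norm_add₃_le).trans ?_
      rw [norm_smul, Real.norm_eq_abs, abs_two]
    refine (e _ _ _ _ _ _ _ _).trans ((add_le_add (add_le_add (add_le_add t1
      (mul_le_mul_of_nonneg_left t2 zero_le_two)) t3) t4).trans ?_)
    set δ := normV O (u - v)
    set Q := normV O u ^ 2 + normV O v ^ 2 + normV O u * normV O v
    set P := (normV O u ^ (2 * n - 1) + normV O v ^ (2 * n - 1)) * (normV O u + normV O v)
    set R := normV O u ^ (2 * n) + normV O v ^ (2 * n)
    set Z := (1 + normV O u ^ 2 + normV O v ^ 2) ^ (1 / 3 : ℝ)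
    have hQ : 0 ≤ Q := by positivity
    have hP : 0 ≤ P := by positivity
    have hR : 0 ≤ R := by positivity
    -- The cube root term serves only as a quantity at least `1`, absorbing the constant left by the
    -- odd power.
    have hZ : 1 ≤ Z := Real.one_le_rpow
      (by nlinarith [sq_nonneg (normV O u), sq_nonneg (normV O v)]) (by norm_num)
    have key : 3 * Q + K₁ * (P + R) + K₂ * (1 + R) ≤ (3 + K₁ + K₂) * (Q + P + R + Z) := by
      have i1 : K₁ * (P + R) ≤ K₁ * (Q + P + R + Z) :=
        mul_le_mul_of_nonneg_left (by linarith) hK₁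
      have i2 : K₂ * (1 + R) ≤ K₂ * (Q + P + R + Z) :=
        mul_le_mul_of_nonneg_left (by linarith) hK₂
      linarith
    have := mul_le_mul_of_nonneg_right key hδ0
    refine le_trans (le_of_eq ?_) this
    ring
  refine ⟨F, fun u => ?_, ⟨3 + K₁ + K₂, hmain⟩, fun R => ?_⟩
  · have hm := memLp_oddPow hd ho hb hn u.2
    simp only [hF]
    filter_upwards [Lp.coeFn_sub (normH20 O u ^ 2 • (u : L2 O) +
        (2 : ℝ) • (normH10 O u ^ 2 • (u : L2 O)) + normLp O (2 * n) u ^ (2 * n) • (u : L2 O))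
        (hm.toLp _),
      Lp.coeFn_add (normH20 O u ^ 2 • (u : L2 O) + (2 : ℝ) • (normH10 O u ^ 2 • (u : L2 O)))
        (normLp O (2 * n) u ^ (2 * n) • (u : L2 O)),
      Lp.coeFn_add (normH20 O u ^ 2 • (u : L2 O)) ((2 : ℝ) • (normH10 O u ^ 2 • (u : L2 O))),
      Lp.coeFn_smul (normH20 O u ^ 2) (u : L2 O),
      Lp.coeFn_smul (2 : ℝ) (normH10 O u ^ 2 • (u : L2 O)),
      Lp.coeFn_smul (normH10 O u ^ 2) (u : L2 O),
      Lp.coeFn_smul (normLp O (2 * n) u ^ (2 * n)) (u : L2 O), hm.coeFn_toLp]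
      with x x1 x2 x3 x4 x5 x6 x7 x8
    rw [x1, Pi.sub_apply, x2, Pi.add_apply, x3, Pi.add_apply, x4, x5, Pi.smul_apply, Pi.smul_apply,
      x6, x7, Pi.smul_apply, Pi.smul_apply, x8, nonlinearity]
    simp only [smul_eq_mul]
    ring
  -- `R` may be negative, while the bracket is monotone on nonnegative arguments.
  · refine ⟨(3 + K₁ + K₂) * bracket (max R 0) (max R 0), fun u v hu hv => (hmain u v).trans ?_⟩
    have hu0 := normV_nonneg (u : L2 O)
    have hv0 := normV_nonneg (v : L2 O)
    have hu' : normV O u ≤ max R 0 := hu.trans (le_max_left _ _)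
    have hv' : normV O v ≤ max R 0 := hv.trans (le_max_left _ _)
    have h1 : 0 ≤ 2 * n - 1 := by linarith
    have h2 : 0 ≤ 2 * n := by linarith
    refine mul_le_mul_of_nonneg_right (mul_le_mul_of_nonneg_left ?_ (by positivity))
      (normV_nonneg _)
    simp only [hbr]
    gcongr
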